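/- Let $E$ be the figure-eight knot, presented as the closure of the three-strand braid $\sigma_1\sigma_2^{-1}\sigma_1\sigma_2^{-1}$. For a knot $K$ and an integer $N\ge 1$ let $J_N(K;t)$ be its colored Jones polynomial corresponding to the $N$-dimensional irreducible representation of $sl_2(\mathbb{C})$, normalized so that $J_N(U;t)=1$ for the unknot $U$. It is a Laurent polynomial with integer coefficients in $t^{1/2}$, defined as follows: if $K$ is the closure of a braid, let the braid act on the tensor power of the $N$-dimensional irreducible representation $V$ of quantum $sl_2$ through the R-matrix, with the framing correction $t^{\mp(N^2-1)/4}$ at each crossing of sign $\pm$, and close all strands but the first by the quantum trace; the result is a scalar endomorphism of $V$, and $J_N(K;t)$ is this scalar, read off at the first basis vector. Let the Alexander polynomial $\Delta(K;t)\in\mathbb{Z}[t,t^{-1}]$ be normalized by $\Delta(K;t^{-1})=\Delta(K;t)$ and $\Delta(K;1)=1$. Then the Alexander polynomial of $E$ is $\Delta(E;t)=-t+3-t^{-1}$. Moreover, if $a$ is a complex number with $|2\cosh a-2|<1$ and $|\operatorname{Im} a|<\pi/3$, then $\Delta(E;e^a)\neq 0$, the sequence $\{J_N(E;\exp(a/N))\}_{N=2,3,\dots}$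 converges (for each $N$, either square root of $\exp(a/N)$ may be taken as the value of $t^{1/2}$), and $$\lim_{N\to\infty}J_N\left(E;\exp\frac{a}{N}\right)=\frac{1}{\Delta(E;\exp a)}.$$ -/

import Mathlib

open scoped LaurentPolynomial

noncomputable section

/-! ## Braid words and the figure-eight knot

An oriented link is presented as the closure of a braid. -/

/-- A word in the generators of the braid group on `n + 1` strands: `(p, true)` is the generator
`σ_p` (a positive crossing of the strands at positions `p` and `p + 1`), and `(p, false)` is its
inverse. -/
abbrev BraidWord (n : ℕ) := List (Fin n × Bool)

/-- The figure-eight knot, as the closure of the three-strand braid `σ₁ σ₂⁻¹ σ₁ σ₂⁻¹`. -/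
def figureEight : BraidWord 2 := [(0, true), (1, false), (0, true), (1, false)]

/-! ## The colored Jones polynomial

All quantities live in `ℤ[s, s⁻¹]`, where `s = T 1` stands for `t ^ (1 / 2)`. -/

/-- The quantum number `{m} = t ^ (m / 2) - t ^ (- m / 2) = s ^ m - s ^ (- m)`. -/
def qNum (m : ℕ) : ℤ[T;T⁻¹] := LaurentPolynomial.T (m : ℤ) - LaurentPolynomial.T (-(m : ℤ))

/-- The quantum factorial `{m}! = {1}{2}⋯{m}`. -/
def qFactorial (m : ℕ) : ℤ[T;T⁻¹] := ∏ i ∈ Finset.range m, qNum (i + 1)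

/-- The balanced quantum binomial coefficient `{a}! / ({b}! {a - b}!)`, as a Laurent polynomial
(see `qBinom_mul_qFactorial`). -/
def qBinom : ℕ → ℕ → ℤ[T;T⁻¹]
  | _, 0 => 1
  | 0, _ + 1 => 0
  | a + 1, b + 1 =>
      LaurentPolynomial.T (-((b : ℤ) + 1)) * qBinom a (b + 1)
        + LaurentPolynomial.T ((a : ℤ) - b) * qBinom a b

theorem qBinom_eq_zero_of_lt {a b : ℕ} (h : a < b) : qBinom a b = 0 := by
  induction a generalizing b with
  | zero =>
    obtain ⟨b, rfl⟩ : ∃ c, b = c + 1 := ⟨b - 1, by omega⟩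
    simp [qBinom]
  | succ a ih =>
    obtain ⟨b, rfl⟩ : ∃ c, b = c + 1 := ⟨b - 1, by omega⟩
    simp [qBinom, ih (show a < b + 1 by omega), ih (show a < b by omega)]

theorem qNum_add (a b : ℕ) :
    LaurentPolynomial.T (-(b : ℤ)) * qNum a + LaurentPolynomial.T (a : ℤ) * qNum b
      = qNum (a + b) := by
  simp only [qNum, mul_sub, ← LaurentPolynomial.T_add]
  push_cast
  rw [show -(b : ℤ) + a = a + -b by ring, show -(b : ℤ) + -a = -(a + b) by ring]
  ring

theorem qFactorial_succ (m : ℕ) : qFactorial (m + 1) = qFactorial m * qNum (m + 1) := by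
  simp [qFactorial, Finset.prod_range_succ]

/-- The recursion defining `qBinom` computes `{a + b}! / ({a}! {b}!)`. -/
theorem qBinom_mul_qFactorial (a b : ℕ) :
    qBinom (a + b) b * (qFactorial a * qFactorial b) = qFactorial (a + b) := by
  induction hn : a + b generalizing a b with
  | zero =>
    obtain ⟨rfl, rfl⟩ : a = 0 ∧ b = 0 := by omega
    simp [qBinom, qFactorial]
  | succ n ih =>
    cases b with
    | zero =>
      obtain rfl : a = n + 1 := by omega
      simp [qBinom, qFactorial]
    | succ b =>
      obtain rfl : n = a + b := by omega
      have h2 := ih a b rfl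
      rw [qBinom, qFactorial_succ (a + b)]
      have e : ((a + b : ℕ) : ℤ) - b = a := by push_cast; ring
      have key := qNum_add a (b + 1)
      rw [show a + (b + 1) = a + b + 1 by ring] at key
      push_cast at key
      rw [e]
      cases a with
      | zero =>
        rw [qBinom_eq_zero_of_lt (show 0 + b < b + 1 by omega), ← key, ← h2, qFactorial_succ b]
        simp only [qNum, Nat.cast_zero, neg_zero, sub_self]
        ring
      | succ a =>
        have h1 := ih a (b + 1) (by omega)
        rw [← key]
        rw [qFactorial_succ b] at h1 ⊢
        rw [qFactorial_succ a] at h2 ⊢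
        linear_combination
          LaurentPolynomial.T (-((b : ℤ) + 1)) * qNum (a + 1) * h1
            + LaurentPolynomial.T ((a + 1 : ℕ) : ℤ) * qNum (b + 1) * h2

/-- The entry `R^{ij}_{kl}` of the R-matrix attached to a positive crossing by the
`N`-dimensional irreducible representation of quantum `sl₂`, with the framing correction
`t ^ (- (N² - 1) / 4)` included. It vanishes unless `l = i + m`, `k = j - m` for some `m ≥ 0`,
and then it equals
`{l}! {N-1-k}! / ({i}! {m}! {N-1-j}!)` times `t` to the power
`(i - (N-1)/2) (j - (N-1)/2) - m (i - j) / 2 - m (m + 1) / 4 - (N² - 1) / 4`. -/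
def posR (N i j k l : ℕ) : ℤ[T;T⁻¹] :=
  if i ≤ l ∧ i + j = k + l then
    qBinom l (l - i) * (∏ x ∈ Finset.range (l - i), qNum (N - j + x)) *
      LaurentPolynomial.T
        (2 * (i : ℤ) * j - ((i : ℤ) + j + 1) * ((N : ℤ) - 1) - ((l : ℤ) - i) * ((i : ℤ) - j)
          - ((l - i + 1).choose 2 : ℕ))
  else 0

/-- The entry `(R⁻¹)^{ij}_{kl}` attached to a negative crossing. It is the image of `R^{ji}_{lk}`
under `t ↦ t⁻¹`: it vanishes unless `l = i - m`, `k = j + m` for some `m ≥ 0`, and then it equals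
`(-1)^m {k}! {N-1-l}! / ({j}! {m}! {N-1-i}!)` times `t` to the power
`- (i - (N-1)/2) (j - (N-1)/2) - m (i - j) / 2 + m (m + 1) / 4 + (N² - 1) / 4`. -/
def negR (N i j k l : ℕ) : ℤ[T;T⁻¹] := LaurentPolynomial.invert (posR N j i l k)

/-- The operator on `V^{⊗(n+1)}`, `V` of dimension `N` with basis indexed by `Fin N`, that a braid
generator or its inverse acts by: the R-matrix, or its inverse, on the tensor factors `p` and
`p + 1`, and the identity on the others. -/
def crossingMatrix (N : ℕ) {n : ℕ} (c : Fin n × Bool) :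
    Matrix (Fin (n + 1) → Fin N) (Fin (n + 1) → Fin N) ℤ[T;T⁻¹] :=
  fun x y =>
    if ∀ q, q ≠ c.1.castSucc → q ≠ c.1.succ → x q = y q then
      (if c.2 then posR else negR) N (x c.1.castSucc) (x c.1.succ) (y c.1.castSucc) (y c.1.succ)
    else 0

/-- The operator on `V^{⊗(n+1)}` of a braid word. -/
def braidMatrix (N : ℕ) {n : ℕ} (w : BraidWord n) :
    Matrix (Fin (n + 1) → Fin N) (Fin (n + 1) → Fin N) ℤ[T;T⁻¹] :=
  (w.map (crossingMatrix N)).prod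

/-- The endomorphism of `V` of the `(1, 1)`-tangle obtained from a braid by closing all strands
but the first: the partial quantum trace, that is, the partial trace after inserting on every
closed strand the diagonal operator with entries `t ^ ((2 i - N + 1) / 2)`, `0 ≤ i < N`. -/
def tangleOperator (N : ℕ) {n : ℕ} (w : BraidWord n) : Matrix (Fin N) (Fin N) ℤ[T;T⁻¹] :=
  fun i j => ∑ z : Fin n → Fin N,
    (∏ p, LaurentPolynomial.T (2 * ((z p : ℕ) : ℤ) - N + 1)) *
      braidMatrix N w (Fin.cons i z) (Fin.cons j z)

/-- The colored Jones polynomial `J_N` of the closure of a braid, for the `N`-dimensional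
irreducible representation (`N ≥ 1`), as a Laurent polynomial in `s = t ^ (1 / 2)`. It is the
scalar by which the `(1, 1)`-tangle acts on the irreducible representation `V`, which is read off
from the first basis vector; so it is `1` for the unknot. -/
def coloredJones (N : ℕ) {n : ℕ} (w : BraidWord n) : ℤ[T;T⁻¹] :=
  if h : 0 < N then tangleOperator N w ⟨0, h⟩ ⟨0, h⟩ else 0

/-- The value of a Laurent polynomial with integer coefficients at a nonzero complex number. -/
def laurentEval (z : ℂˣ) (P : ℤ[T;T⁻¹]) : ℂ := LaurentPolynomial.eval₂ (Int.castRingHom ℂ) z P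

/-! ## The Alexander polynomial

Here `T 1` stands for `t`. -/

/-- The (unreduced) Burau matrix of a braid generator or its inverse: the block
`(1 - t, t; 1, 0)`, or its inverse `(0, 1; t⁻¹, 1 - t⁻¹)`, in the rows and columns `p`, `p + 1`,
and the identity elsewhere. -/
def burauGenerator {n : ℕ} (c : Fin n × Bool) :
    Matrix (Fin (n + 1)) (Fin (n + 1)) ℤ[T;T⁻¹] :=
  fun i j =>
    if i = c.1.castSucc ∧ j = c.1.castSucc then
      (if c.2 then 1 - LaurentPolynomial.T 1 else 0)
    else if i = c.1.castSucc ∧ j = c.1.succ then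
      (if c.2 then LaurentPolynomial.T 1 else 1)
    else if i = c.1.succ ∧ j = c.1.castSucc then
      (if c.2 then 1 else LaurentPolynomial.T (-1))
    else if i = c.1.succ ∧ j = c.1.succ then
      (if c.2 then 0 else 1 - LaurentPolynomial.T (-1))
    else if i = j then 1 else 0

/-- The Burau matrix of a braid word. -/
def burauMatrix {n : ℕ} (w : BraidWord n) : Matrix (Fin (n + 1)) (Fin (n + 1)) ℤ[T;T⁻¹] :=
  (w.map burauGenerator).prod

/-- `Δ` is the normalized Alexander polynomial of the knot that is the closure of `w`: up to a
unit of `ℤ[t, t⁻¹]` it is the determinant of the Alexander matrix `1 - burauMatrix w` (the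
matrix of Fox derivatives of the presentation of the knot group that `w` gives) with one row and
one column deleted, and it satisfies `Δ(t⁻¹) = Δ(t)` and `Δ(1) = 1`. -/
def IsAlexanderPolynomial {n : ℕ} (w : BraidWord n) (Δ : ℤ[T;T⁻¹]) : Prop :=
  Associated Δ ((1 - burauMatrix w).submatrix Fin.succ Fin.succ).det ∧
    LaurentPolynomial.invert Δ = Δ ∧
    LaurentPolynomial.eval₂ (RingHom.id ℤ) 1 Δ = 1

end

/-! Write `{m}` for `qNum m`. The limit rests on the cyclotomic formula of Habiro and Lê
(`coloredJones_figureEight`), which writes `J_N` as the sum over `k < N` of the products over `1 ≤ j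
≤ k` of `{N + j}{N - j}`. At `t = exp (a / N)` each factor equals `2 cosh a - 2 cosh (a j / N)`. For
fixed `j` it tends to `r = 2 cosh a - 2`, so the sum tends formally to the geometric series of `r`,
that is to `1 / (3 - 2 cosh a) = 1 / Δ(e^a)`. The exchange of limit and sum is dominated
convergence: `norm_cosh_sub_cosh_le` bounds every factor by `‖r‖ < 1`.

The formula itself is derived from the R-matrix. The crossings commute with the coproduct of the
lowering operator of quantum `sl₂`, and the quantum trace turns this into equality of all diagonal
entries of the tangle operator (`tangleOperator_apply_self`). So the scalar may be read off at the
last basis vector instead of the first. There both positive crossings can only exchange their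
labels, and the state sum collapses to an explicit double sum. Two applications of the `q`-binomial
theorem and one of `q`-Chu–Vandermonde reduce it to the cyclotomic sum
(`sum_eq_cyclotomic_expansion`).

The Alexander polynomial is a 2 × 2 determinant. It is unique because a symmetric unit of `ℤ[t,
t⁻¹]` with value `1` at `t = 1` is `1`. -/

/-! ### Quantum integers, factorials and binomials -/

section QuantumNumbers

open LaurentPolynomial Finset

theorem qNum_zero : qNum 0 = 0 := by simp [qNum]

theorem qNum_ne_zero {m : ℕ} (hm : 0 < m) : qNum m ≠ 0 := by
  intro h
  have h1 : (qNum m).coeff (m : ℤ) = (0 : ℤ[T;T⁻¹]).coeff (m : ℤ) := by rw [h]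
  have h2 : -(m : ℤ) ≠ m := by omega
  simp [qNum, h2] at h1

theorem qFactorial_ne_zero (m : ℕ) : qFactorial m ≠ 0 :=
  Finset.prod_ne_zero_iff.2 fun i _ => qNum_ne_zero i.succ_pos

theorem qFactorial_zero : qFactorial 0 = 1 := by simp [qFactorial]

theorem invert_qNum (m : ℕ) : invert (qNum m) = -qNum m := by
  simp [qNum]

theorem invert_qFactorial (m : ℕ) : invert (qFactorial m) = (-1) ^ m * qFactorial m := by
  induction m with
  | zero => simp [qFactorial_zero]
  | succ m ih => rw [qFactorial_succ, map_mul, ih, invert_qNum]; ring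

theorem qBinom_zero_right (a : ℕ) : qBinom a 0 = 1 := by cases a <;> rfl

theorem qBinom_self (a : ℕ) : qBinom a a = 1 := by
  have h := qBinom_mul_qFactorial 0 a
  rw [qFactorial_zero, one_mul, zero_add] at h
  exact mul_right_cancel₀ (qFactorial_ne_zero a) (h.trans (one_mul _).symm)

/-- Numerator and denominator of the factorial quotient acquire the same sign. -/
theorem invert_qBinom (a b : ℕ) : invert (qBinom a b) = qBinom a b := by
  rcases lt_or_ge a b with h | h
  · simp [qBinom_eq_zero_of_lt h]
  · obtain ⟨c, rfl⟩ := Nat.exists_eq_add_of_le' h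
    have h1 := qBinom_mul_qFactorial c b
    have h2 := congrArg invert h1
    rw [map_mul, map_mul, invert_qFactorial, invert_qFactorial, invert_qFactorial, ← h1] at h2
    have h3 : ((-1) ^ (c + b) * (qFactorial c * qFactorial b) : ℤ[T;T⁻¹]) ≠ 0 :=
      mul_ne_zero (pow_ne_zero _ (by simp))
        (mul_ne_zero (qFactorial_ne_zero _) (qFactorial_ne_zero _))
    refine mul_right_cancel₀ h3 ?_
    linear_combination h2

theorem qBinom_succ_right_mul (i m : ℕ) :
    qBinom (i + m) (m + 1) * qNum (m + 1) = qBinom (i + m) m * qNum i := by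
  cases i with
  | zero => rw [qBinom_eq_zero_of_lt (by omega), qNum_zero]; ring
  | succ i =>
    have h1 := qBinom_mul_qFactorial i (m + 1)
    have h2 := qBinom_mul_qFactorial (i + 1) m
    rw [qFactorial_succ] at h1 h2
    rw [show i + 1 + m = i + (m + 1) by ring] at h2 ⊢
    refine mul_right_cancel₀ (mul_ne_zero (qFactorial_ne_zero i) (qFactorial_ne_zero m)) ?_
    linear_combination h1 - h2

theorem qBinom_succ_succ_mul (i m : ℕ) :
    qBinom (i + m + 1) (m + 1) * qNum (m + 1) = qBinom (i + m) m * qNum (i + m + 1) := by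
  have h1 := qBinom_mul_qFactorial i (m + 1)
  have h2 := qBinom_mul_qFactorial i m
  rw [← add_assoc, qFactorial_succ m, qFactorial_succ (i + m), ← h2] at h1
  refine mul_right_cancel₀ (mul_ne_zero (qFactorial_ne_zero i) (qFactorial_ne_zero m)) ?_
  linear_combination h1

theorem prod_qNum_mul_qFactorial (n m : ℕ) :
    (∏ x ∈ range m, qNum (n + 1 + x)) * qFactorial n = qFactorial (n + m) := by
  induction m with
  | zero => simp
  | succ m ih =>
    rw [prod_range_succ, ← add_assoc, qFactorial_succ (n + m), ← ih,
      show n + 1 + m = n + m + 1 by ring]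
    ring

theorem prod_qNum_sub_mul_qFactorial (n m : ℕ) :
    (∏ x ∈ range m, qNum (n + m - x)) * qFactorial n = qFactorial (n + m) := by
  rw [← prod_qNum_mul_qFactorial, ← prod_range_reflect]
  congr 1
  refine prod_congr rfl fun x hx => ?_
  have := mem_range.1 hx
  congr 1
  omega

theorem two_mul_choose_two (m : ℕ) : 2 * ((m.choose 2 : ℕ) : ℤ) = m * (m - 1) := by
  induction m with
  | zero => simp
  | succ m ih =>
    rw [Nat.choose_succ_succ' m 1, Nat.choose_one_right]
    push_cast
    linear_combination ih

end QuantumNumbers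

/-! ### Entrywise commutation of the R-matrix with the lowering operator -/

section RMatrix

open LaurentPolynomial Finset

theorem posR_eq_zero {N i j k l : ℕ} (h : ¬(i ≤ l ∧ i + j = k + l)) : posR N i j k l = 0 :=
  if_neg h

theorem posR_add (N i k m : ℕ) :
    posR N i (k + m) k (i + m) = qBinom (i + m) m * (∏ x ∈ range m, qNum (N - (k + m) + x)) *
      T (2 * (i : ℤ) * (k + m) - ((i : ℤ) + k + m + 1) * ((N : ℤ) - 1) - m * ((i : ℤ) - k - m)
        - ((m + 1).choose 2 : ℕ)) := by
  rw [posR, if_pos (by omega), Nat.add_sub_cancel_left]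
  congr 2
  push_cast
  ring

/-- The relation between powers of `s` behind the commutation of the R-matrix with the
coproduct of the lowering operator. -/
theorem qNum_mul_qNum_relation {N i m : ℕ} (h : i + m + 1 ≤ N) :
    T ((N : ℤ) - 1 - i) * (qNum (N - i) * qNum i) + T (2 * (N : ℤ) - 2 - 3 * i - m) * qNum (m + 1)
      = T ((i : ℤ) + m) * qNum (m + 1)
        + T ((N : ℤ) - 1 - i) * (qNum (N - (i + m + 1)) * qNum (i + m + 1)) := by
  obtain ⟨p, rfl⟩ := Nat.exists_eq_add_of_le' h
  rw [show p + (i + m + 1) - i = p + m + 1 by omega, Nat.add_sub_cancel]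
  simp only [qNum, mul_sub, sub_mul, ← T_add]
  push_cast
  ring_nf

/-- This is the matrix entry of `Δ(F) R = R Δ(F)`, with `Δ(F)` of the form `F ⊗ K + K⁻¹ ⊗ F` up to
scaling. The guards on the left exclude truncated indices. None is needed on the right, where an
index reaching `N` is killed by the factor `{0}`. -/
theorem posR_lowering {N i j k l : ℕ} (hi : i < N) (hj : j < N) (hl : l < N) :
    (if 1 ≤ i then qNum (N - i) * T (j : ℤ) * posR N (i - 1) j k l else 0)
      + (if 1 ≤ j then T ((N : ℤ) - 1 - i) * qNum (N - j) * posR N i (j - 1) k l else 0)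
    = posR N i j (k + 1) l * (qNum (N - (k + 1)) * T (l : ℤ))
      + posR N i j k (l + 1) * (T ((N : ℤ) - 1 - k) * qNum (N - (l + 1))) := by
  by_cases hs : i + j = k + l + 1; swap
  · rw [posR_eq_zero (l := l + 1) (by omega), posR_eq_zero (k := k + 1) (by omega)]
    split_ifs with h1 h2 h2
    · rw [posR_eq_zero (by omega), posR_eq_zero (by omega)]; ring
    · rw [posR_eq_zero (by omega)]; ring
    · rw [posR_eq_zero (by omega)]; ring
    · ring
  rcases lt_trichotomy (l + 1) i with h | rfl | h
  · rw [posR_eq_zero (l := l + 1) (by omega), posR_eq_zero (k := k + 1) (by omega)]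
    split_ifs with h1 h2 h2
    · rw [posR_eq_zero (by omega), posR_eq_zero (by omega)]; ring
    · rw [posR_eq_zero (by omega)]; ring
    · rw [posR_eq_zero (by omega)]; ring
    · ring
  · obtain rfl : j = k := by omega
    rw [posR_eq_zero (k := j + 1) (by omega), if_pos (by omega),
      posR_eq_zero (i := l + 1) (k := j) (l := l) (by omega), mul_zero, ite_self]
    have h1 := posR_add N l j 0
    have h2 := posR_add N (l + 1) j 0
    simp only [add_zero, qBinom_zero_right, prod_range_zero, mul_one, one_mul] at h1 h2
    simp only [add_tsub_cancel_right, h1, h2, add_zero, zero_mul, zero_add]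
    rw [mul_assoc, ← T_add, mul_left_comm, ← mul_assoc, ← T_add, mul_comm]
    congr 2
    push_cast
    ring
  -- Generic case: the four entries, in order, lower and raise their labels by `m + 1`, `m`, `m` and
  -- `m + 1`.
  · obtain ⟨m, rfl⟩ := Nat.exists_eq_add_of_le (show i ≤ l by omega)
    obtain rfl : j = k + 1 + m := by omega
    rw [if_pos (show 1 ≤ k + 1 + m by omega)]
    have c1 : ((m + 1 + 1).choose 2 : ℤ) = (m + 1).choose 2 + m + 1 := by
      rw [Nat.choose_succ_succ' (m + 1) 1, Nat.choose_one_right]; push_cast; ring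
    -- At `i = 0` the guarded term is absent and the binomial vanishes, so one formula covers all
    -- `i`.
    have hA : (if 1 ≤ i then
        qNum (N - i) * T ((k + 1 + m : ℕ) : ℤ) * posR N (i - 1) (k + 1 + m) k (i + m) else 0)
        = qNum (N - i) * T ((k + 1 + m : ℕ) : ℤ) * (qBinom (i + m) (m + 1) *
          (∏ x ∈ range (m + 1), qNum (N - (k + (m + 1)) + x)) *
          T (2 * ((i : ℤ) - 1) * (k + (m + 1 : ℕ)) - ((i : ℤ) - 1 + k + (m + 1 : ℕ) + 1) * ((N : ℤ) - 1)
            - (m + 1 : ℕ) * ((i : ℤ) - 1 - k - (m + 1 : ℕ)) - ((m + 1 + 1).choose 2 : ℕ))) := by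
      split_ifs with h1
      · obtain ⟨i, rfl⟩ := Nat.exists_eq_add_of_le' h1
        have := posR_add N i k (m + 1)
        rw [show i + 1 - 1 = i by omega, show k + 1 + m = k + (m + 1) by ring,
          show i + 1 + m = i + (m + 1) by ring, this]
        push_cast
        rw [show (i : ℤ) + 1 - 1 = i by ring]
      · rw [qBinom_eq_zero_of_lt (by omega)]; ring
    have hB := posR_add N i k m
    have hC := posR_add N i (k + 1) m
    have hD := posR_add N i k (m + 1)
    rw [hA, show k + 1 + m - 1 = k + m by omega, hB, hC,
      show k + 1 + m = k + (m + 1) by ring, show i + m + 1 = i + (m + 1) by ring, hD]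
    have hP : ∏ x ∈ range (m + 1), qNum (N - (k + (m + 1)) + x)
        = (∏ x ∈ range m, qNum (N - (k + m) + x)) * qNum (N - (k + (m + 1))) := by
      rw [prod_range_succ', add_zero]
      congr 1
      refine prod_congr rfl fun x _ => ?_
      congr 1
      omega
    have hP' : (∏ x ∈ range m, qNum (N - (k + (m + 1)) + x)) * qNum (N - (k + 1))
        = ∏ x ∈ range (m + 1), qNum (N - (k + (m + 1)) + x) := by
      rw [prod_range_succ]
      congr 2
      omega
    have b1 := qBinom_succ_right_mul i m
    have b2 := qBinom_succ_succ_mul i m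
    have key := qNum_mul_qNum_relation (show i + m + 1 ≤ N by omega)
    set P := ∏ x ∈ range (m + 1), qNum (N - (k + (m + 1)) + x)
    set B : ℤ := 2 * (i : ℤ) * (k + 1 + m) - ((i : ℤ) + k + 1 + m + 1) * ((N : ℤ) - 1)
      - m * ((i : ℤ) - k - 1 - m) - ((m + 1).choose 2 : ℕ) with hBdef
    have e1 : T ((k + (m + 1) : ℕ) : ℤ) * T (2 * ((i : ℤ) - 1) * (k + (m + 1 : ℕ))
        - ((i : ℤ) - 1 + k + (m + 1 : ℕ) + 1) * ((N : ℤ) - 1)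
        - (m + 1 : ℕ) * ((i : ℤ) - 1 - k - (m + 1 : ℕ)) - ((m + 1 + 1).choose 2 : ℕ))
        = (T B * T ((N : ℤ) - 1 - i) : ℤ[T;T⁻¹]) := by
      rw [← T_add, ← T_add, c1, hBdef]; congr 1; push_cast; ring
    have e2 : T ((N : ℤ) - 1 - i) * T (2 * (i : ℤ) * (k + m)
        - ((i : ℤ) + k + m + 1) * ((N : ℤ) - 1) - m * ((i : ℤ) - k - m) - ((m + 1).choose 2 : ℕ))
        = (T B * T (2 * (N : ℤ) - 2 - 3 * i - m) : ℤ[T;T⁻¹]) := by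
      rw [← T_add, ← T_add, hBdef]; congr 1; ring
    have e3 : T (2 * (i : ℤ) * ((k + 1 : ℕ) + m)
        - ((i : ℤ) + (k + 1 : ℕ) + m + 1) * ((N : ℤ) - 1) - m * ((i : ℤ) - (k + 1 : ℕ) - m)
          - ((m + 1).choose 2 : ℕ)) * T ((i + m : ℕ) : ℤ)
        = (T B * T ((i : ℤ) + m) : ℤ[T;T⁻¹]) := by
      rw [← T_add, ← T_add, hBdef]; congr 1; push_cast; ring
    have e4 : T (2 * (i : ℤ) * (k + (m + 1 : ℕ))
        - ((i : ℤ) + k + (m + 1 : ℕ) + 1) * ((N : ℤ) - 1) - (m + 1 : ℕ) * ((i : ℤ) - k - (m + 1 : ℕ))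
          - ((m + 1 + 1).choose 2 : ℕ)) * T ((N : ℤ) - 1 - k)
        = (T B * T ((N : ℤ) - 1 - i) : ℤ[T;T⁻¹]) := by
      rw [← T_add, ← T_add, c1, hBdef]; congr 1; push_cast; ring
    -- The factor `{m + 1}` turns the binomials with lower index `m + 1` into multiples of `qBinom
    -- (i + m) m`. Once the common factors are removed, `key` remains.
    refine mul_right_cancel₀ (qNum_ne_zero m.succ_pos) ?_
    rw [← add_assoc i m 1]
    linear_combination
      qNum (N - i) * qBinom (i + m) (m + 1) * P * qNum (m + 1) * e1
      + qNum (N - i) * P * T B * T ((N : ℤ) - 1 - i) * b1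
      + qBinom (i + m) m * (∏ x ∈ range m, qNum (N - (k + m) + x)) * qNum (N - (k + (m + 1)))
        * qNum (m + 1) * e2
      - qBinom (i + m) m * T B * T (2 * (N : ℤ) - 2 - 3 * i - m) * qNum (m + 1) * hP
      - qBinom (i + m) m * (∏ x ∈ range m, qNum (N - (k + (m + 1)) + x)) * qNum (N - (k + 1))
        * qNum (m + 1) * e3
      - qBinom (i + m) m * T B * T ((i : ℤ) + m) * qNum (m + 1) * hP'
      - qBinom (i + m + 1) (m + 1) * P * qNum (N - (i + m + 1)) * qNum (m + 1) * e4
      - P * T B * T ((N : ℤ) - 1 - i) * qNum (N - (i + m + 1)) * b2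
      + qBinom (i + m) m * P * T B * key

theorem negR_lowering {N i j k l : ℕ} (hi : i < N) (hj : j < N) (hk : k < N) :
    (if 1 ≤ i then qNum (N - i) * T (j : ℤ) * negR N (i - 1) j k l else 0)
      + (if 1 ≤ j then T ((N : ℤ) - 1 - i) * qNum (N - j) * negR N i (j - 1) k l else 0)
    = negR N i j (k + 1) l * (qNum (N - (k + 1)) * T (l : ℤ))
      + negR N i j k (l + 1) * (T ((N : ℤ) - 1 - k) * qNum (N - (l + 1))) := by
  -- Inverting `t` and swapping the tensor factors exchanges `K` and `K⁻¹` twice. The prefactor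
  -- absorbs the sign of `{m}` under inversion and the scaling by `T (N - 1)` between the weight
  -- matrix's inverse and the coweight matrix.
  have h := congrArg (fun P => -T ((N : ℤ) - 1) * invert P) (posR_lowering (k := l) hj hi hk)
  simp only [map_add, map_mul, invert_qNum, invert_T, apply_ite invert, map_zero, mul_add, mul_ite,
    mul_zero] at h
  simp only [negR]
  have s (a b : ℤ) (x y : ℤ[T;T⁻¹]) (hab : (N : ℤ) - 1 + a = b) :
      -T ((N : ℤ) - 1) * (-x * T a * y) = T b * x * y := by
    rw [← hab, T_add]; ring
  have s' (a b : ℤ) (x y : ℤ[T;T⁻¹]) (hab : (N : ℤ) - 1 + a = b) :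
      -T ((N : ℤ) - 1) * (T a * -x * y) = x * T b * y := by
    rw [← hab, T_add]; ring
  have s'' (a b : ℤ) (x y : ℤ[T;T⁻¹]) (hab : (N : ℤ) - 1 + a = b) :
      -T ((N : ℤ) - 1) * (y * (-x * T a)) = y * (T b * x) := by
    rw [← hab, T_add]; ring
  have s''' (a b : ℤ) (x y : ℤ[T;T⁻¹]) (hab : (N : ℤ) - 1 + a = b) :
      -T ((N : ℤ) - 1) * (y * (T a * -x)) = y * (x * T b) := by
    rw [← hab, T_add]; ring
  rw [s _ ((N : ℤ) - 1 - i) _ _ (by ring), s' _ (j : ℤ) _ _ (by ring),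
    s'' _ ((N : ℤ) - 1 - k) _ _ (by ring), s''' _ (l : ℤ) _ _ (by ring)] at h
  rw [add_comm, h, add_comm]

end RMatrix

/-! ### Diagonal entries of the tangle operator agree -/

section LoweringOperator

open LaurentPolynomial Finset Matrix
open scoped Kronecker

/-- The lowering operator on the `N`-dimensional representation, acting on rows. -/
noncomputable def loweringMatrix (N : ℕ) : Matrix (Fin N) (Fin N) ℤ[T;T⁻¹] :=
  fun i j => if (i : ℕ) = j + 1 then qNum (N - i) else 0

/-- A square root of the weight operator, up to a scalar. -/
noncomputable def weightMatrix (N : ℕ) : Matrix (Fin N) (Fin N) ℤ[T;T⁻¹] :=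
  diagonal fun i => T ((i : ℕ) : ℤ)

/-- A scalar multiple of the inverse of `weightMatrix N`. -/
noncomputable def coweightMatrix (N : ℕ) : Matrix (Fin N) (Fin N) ℤ[T;T⁻¹] :=
  diagonal fun i => T ((N : ℤ) - 1 - (i : ℕ))

/-- The R-matrix or its inverse, as an operator on `V ⊗ V`. -/
noncomputable def crossingPair (N : ℕ) (b : Bool) :
    Matrix (Fin N × Fin N) (Fin N × Fin N) ℤ[T;T⁻¹] :=
  fun x y => (if b then posR else negR) N x.1 x.2 y.1 y.2

/-- The coproduct of the lowering operator, on `V ⊗ V`. -/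
noncomputable def loweringPair (N : ℕ) : Matrix (Fin N × Fin N) (Fin N × Fin N) ℤ[T;T⁻¹] :=
  loweringMatrix N ⊗ₖ weightMatrix N + coweightMatrix N ⊗ₖ loweringMatrix N

theorem sum_loweringMatrix_mul {N : ℕ} (i : Fin N) (f : ℕ → ℤ[T;T⁻¹]) :
    ∑ i', loweringMatrix N i i' * f (i' : ℕ)
      = if 1 ≤ (i : ℕ) then qNum (N - i) * f ((i : ℕ) - 1) else 0 := by
  split_ifs with h
  · rw [sum_eq_single (⟨i - 1, by omega⟩ : Fin N)]
    · simp [loweringMatrix, Nat.sub_add_cancel h]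
    · intro b _ hb
      rw [loweringMatrix, if_neg, zero_mul]
      intro h'
      exact hb (Fin.ext (by simp [h']))
    · simp
  · refine sum_eq_zero fun j _ => ?_
    rw [loweringMatrix, if_neg (by omega), zero_mul]

theorem sum_mul_loweringMatrix {N : ℕ} (i : Fin N) (f : ℕ → ℤ[T;T⁻¹]) :
    ∑ i' : Fin N, f (i' : ℕ) * loweringMatrix N i' i = f ((i : ℕ) + 1) * qNum (N - ((i : ℕ) + 1)) := by
  by_cases h : (i : ℕ) + 1 < N
  · rw [sum_eq_single (⟨i + 1, h⟩ : Fin N)]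
    · simp [loweringMatrix]
    · intro b _ hb
      rw [loweringMatrix, if_neg, mul_zero]
      intro h'
      exact hb (Fin.ext (by simp [h']))
    · simp
  · rw [show N - ((i : ℕ) + 1) = 0 by omega, qNum_zero, mul_zero]
    refine sum_eq_zero fun j _ => ?_
    rw [loweringMatrix, if_neg (by omega), mul_zero]

theorem crossing_eq_zero {N i j k l : ℕ} (b : Bool) (h : i + j ≠ k + l) :
    (if b then posR else negR) N i j k l = 0 := by
  cases b
  · simp only [Bool.false_eq_true, if_false, negR]
    rw [posR_eq_zero (by omega), map_zero]
  · exact posR_eq_zero (by omega)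

/-- A crossing preserves the sum of its two labels. This handles the grouplike factors `K ⊗ K` and
`K⁻¹ ⊗ K⁻¹` when the lowering operator acts on the uninvolved strand. -/
theorem crossingPair_commute_diagonal (N : ℕ) (b : Bool) (f : ℕ → ℤ[T;T⁻¹]) :
    Commute (diagonal fun x : Fin N × Fin N => f (x.1 + x.2)) (crossingPair N b) := by
  ext x y : 2
  rw [diagonal_mul, mul_diagonal]
  by_cases h : (x.1 + x.2 : ℕ) = y.1 + y.2
  · rw [h, mul_comm]
  · rw [crossingPair, crossing_eq_zero b h, mul_zero, zero_mul]

theorem weightMatrix_kronecker (N : ℕ) :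
    weightMatrix N ⊗ₖ weightMatrix N
      = diagonal fun x : Fin N × Fin N => T ((x.1 + x.2 : ℕ) : ℤ) := by
  simp only [weightMatrix, diagonal_kronecker_diagonal, ← T_add, Nat.cast_add]

theorem coweightMatrix_kronecker (N : ℕ) :
    coweightMatrix N ⊗ₖ coweightMatrix N
      = diagonal fun x : Fin N × Fin N => T (2 * ((N : ℤ) - 1) - ((x.1 + x.2 : ℕ) : ℤ)) := by
  simp only [coweightMatrix, diagonal_kronecker_diagonal, ← T_add, Nat.cast_add]
  congr 1
  ext1 x
  congr 1
  ring

theorem crossing_lowering {N i j k l : ℕ} (b : Bool) (hi : i < N) (hj : j < N) (hk : k < N)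
    (hl : l < N) :
    (if 1 ≤ i then qNum (N - i) * (T (j : ℤ) * (if b then posR else negR) N (i - 1) j k l) else 0)
      + (if 1 ≤ j then
          qNum (N - j) * (T ((N : ℤ) - 1 - i) * (if b then posR else negR) N i (j - 1) k l) else 0)
    = (if b then posR else negR) N i j (k + 1) l * T (l : ℤ) * qNum (N - (k + 1))
      + (if b then posR else negR) N i j k (l + 1) * T ((N : ℤ) - 1 - k) * qNum (N - (l + 1)) := by
  have key : ∀ R : ℕ → ℕ → ℕ → ℕ → ℕ → ℤ[T;T⁻¹],
      (if 1 ≤ i then qNum (N - i) * T (j : ℤ) * R N (i - 1) j k l else 0)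
      + (if 1 ≤ j then T ((N : ℤ) - 1 - i) * qNum (N - j) * R N i (j - 1) k l else 0)
      = R N i j (k + 1) l * (qNum (N - (k + 1)) * T (l : ℤ))
      + R N i j k (l + 1) * (T ((N : ℤ) - 1 - k) * qNum (N - (l + 1))) →
      (if 1 ≤ i then qNum (N - i) * (T (j : ℤ) * R N (i - 1) j k l) else 0)
      + (if 1 ≤ j then qNum (N - j) * (T ((N : ℤ) - 1 - i) * R N i (j - 1) k l) else 0)
      = R N i j (k + 1) l * T (l : ℤ) * qNum (N - (k + 1))
      + R N i j k (l + 1) * T ((N : ℤ) - 1 - k) * qNum (N - (l + 1)) := by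
    intro R h
    rw [mul_assoc (R N i j (k + 1) l), mul_comm (T (l : ℤ)), mul_assoc (R N i j k (l + 1)), ← h,
      ← mul_assoc, ← mul_assoc, mul_comm (qNum (N - j))]
  cases b
  · exact key _ (negR_lowering hi hj hk)
  · exact key _ (posR_lowering hi hj hl)

theorem crossingPair_commute_loweringPair (N : ℕ) (b : Bool) :
    Commute (loweringPair N) (crossingPair N b) := by
  ext ⟨i, j⟩ ⟨k, l⟩ : 2
  have h := crossing_lowering b i.2 j.2 k.2 l.2
  set R : ℕ → ℕ → ℕ → ℕ → ℕ → ℤ[T;T⁻¹] := if b then posR else negR with hR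
  have h1 := sum_loweringMatrix_mul i fun i' => T ((j : ℕ) : ℤ) * R N i' j k l
  have h2 := sum_loweringMatrix_mul j fun j' => T ((N : ℤ) - 1 - (i : ℕ)) * R N i j' k l
  have h3 := sum_mul_loweringMatrix k fun k' => R N i j k' l * T ((l : ℕ) : ℤ)
  have h4 := sum_mul_loweringMatrix l fun l' => R N i j k l' * T ((N : ℤ) - 1 - (k : ℕ))
  rw [← h1, ← h2, ← h3, ← h4] at h
  have l1 : ∑ x : Fin N × Fin N, (loweringMatrix N ⊗ₖ weightMatrix N) (i, j) x
      * crossingPair N b x (k, l)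
      = ∑ i', loweringMatrix N i i' * (T ((j : ℕ) : ℤ) * R N i' j k l) := by
    rw [Fintype.sum_prod_type]
    refine sum_congr rfl fun i' _ => ?_
    simp [weightMatrix, kroneckerMap_apply, diagonal_apply, crossingPair, ← hR, mul_assoc]
  have l2 : ∑ x : Fin N × Fin N, (coweightMatrix N ⊗ₖ loweringMatrix N) (i, j) x
      * crossingPair N b x (k, l)
      = ∑ j', loweringMatrix N j j' * (T ((N : ℤ) - 1 - (i : ℕ)) * R N i j' k l) := by
    rw [Fintype.sum_prod_type_right]
    refine sum_congr rfl fun j' _ => ?_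
    simp [coweightMatrix, kroneckerMap_apply, diagonal_apply, crossingPair, ← hR, mul_assoc]
  have l3 : ∑ x : Fin N × Fin N, crossingPair N b (i, j) x
      * (loweringMatrix N ⊗ₖ weightMatrix N) x (k, l)
      = ∑ k' : Fin N, R N i j k' l * T ((l : ℕ) : ℤ) * loweringMatrix N k' k := by
    rw [Fintype.sum_prod_type]
    refine sum_congr rfl fun k' _ => ?_
    simp only [weightMatrix, kroneckerMap_apply, diagonal_apply, crossingPair, ← hR, mul_ite,
      mul_zero, sum_ite_eq', mem_univ, if_true]
    ring
  have l4 : ∑ x : Fin N × Fin N, crossingPair N b (i, j) x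
      * (coweightMatrix N ⊗ₖ loweringMatrix N) x (k, l)
      = ∑ l' : Fin N, R N i j k l' * T ((N : ℤ) - 1 - (k : ℕ)) * loweringMatrix N l' l := by
    rw [Fintype.sum_prod_type_right]
    refine sum_congr rfl fun l' _ => ?_
    simp [coweightMatrix, kroneckerMap_apply, diagonal_apply, crossingPair, ← hR, mul_assoc]
  rw [loweringPair, add_mul, mul_add, Matrix.add_apply, Matrix.add_apply, mul_apply, mul_apply, mul_apply,
    mul_apply, l1, l2, l3, l4, h]

/-- Triples of basis indices as functions on `Fin 3`. -/
def tripleEquiv (N : ℕ) : Fin N × Fin N × Fin N ≃ (Fin 3 → Fin N) where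
  toFun x := Fin.cons x.1 ![x.2.1, x.2.2]
  invFun f := (f 0, f 1, f 2)
  left_inv _ := rfl
  right_inv f := by ext i; fin_cases i <;> rfl

/-- The coproduct of the lowering operator, on `V ⊗ V ⊗ V`. -/
noncomputable def loweringTriple (N : ℕ) :
    Matrix (Fin N × Fin N × Fin N) (Fin N × Fin N × Fin N) ℤ[T;T⁻¹] :=
  loweringMatrix N ⊗ₖ (weightMatrix N ⊗ₖ weightMatrix N) + coweightMatrix N ⊗ₖ loweringPair N

theorem crossingMatrix_zero (N : ℕ) (b : Bool) :
    (crossingMatrix N ((0 : Fin 2), b)).submatrix (tripleEquiv N) (tripleEquiv N)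
      = reindex (Equiv.prodAssoc _ _ _) (Equiv.prodAssoc _ _ _)
          (crossingPair N b ⊗ₖ (1 : Matrix (Fin N) (Fin N) ℤ[T;T⁻¹])) := by
  ext ⟨i, j, k⟩ ⟨i', j', k'⟩ : 2
  simp [crossingMatrix, tripleEquiv, Fin.forall_fin_succ, kroneckerMap_apply, one_apply,
    crossingPair]

theorem crossingMatrix_one (N : ℕ) (b : Bool) :
    (crossingMatrix N ((1 : Fin 2), b)).submatrix (tripleEquiv N) (tripleEquiv N)
      = (1 : Matrix (Fin N) (Fin N) ℤ[T;T⁻¹]) ⊗ₖ crossingPair N b := by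
  ext ⟨i, j, k⟩ ⟨i', j', k'⟩ : 2
  simp [crossingMatrix, tripleEquiv, Fin.forall_fin_succ, kroneckerMap_apply, one_apply,
    crossingPair]

/-- Coassociativity of the coproduct: the grouping suited to `σ₁` agrees with the one suited to
`σ₂`. -/
theorem loweringTriple_eq_reindex (N : ℕ) :
    loweringTriple N = reindex (Equiv.prodAssoc _ _ _) (Equiv.prodAssoc _ _ _)
      (loweringPair N ⊗ₖ weightMatrix N
        + (coweightMatrix N ⊗ₖ coweightMatrix N) ⊗ₖ loweringMatrix N) := by
  rw [reindex_apply, submatrix_add, Pi.add_apply, Pi.add_apply, ← reindex_apply, ← reindex_apply,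
    kronecker_assoc, loweringPair, add_kronecker, ← coe_reindexLinearEquiv ℤ[T;T⁻¹] ℤ[T;T⁻¹],
    map_add, coe_reindexLinearEquiv, kronecker_assoc, kronecker_assoc,
    loweringTriple, loweringPair, kronecker_add, add_assoc]

theorem crossingMatrix_commute_loweringTriple (N : ℕ) (c : Fin 2 × Bool) :
    Commute (loweringTriple N)
      ((crossingMatrix N c).submatrix (tripleEquiv N) (tripleEquiv N)) := by
  obtain ⟨p, b⟩ := c
  have hD := crossingPair_commute_diagonal N b fun n => T (n : ℤ)
  have hD' := crossingPair_commute_diagonal N b fun n => T (2 * ((N : ℤ) - 1) - (n : ℤ))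
  have hL := crossingPair_commute_loweringPair N b
  rw [← weightMatrix_kronecker] at hD
  rw [← coweightMatrix_kronecker] at hD'
  fin_cases p
  · change Commute _ ((crossingMatrix N ((0 : Fin 2), b)).submatrix _ _)
    rw [crossingMatrix_zero, loweringTriple_eq_reindex, commute_iff_eq, ← coe_reindexAlgEquiv ℤ ℤ[T;T⁻¹],
      ← map_mul, ← map_mul, add_mul, mul_add, ← mul_kronecker_mul,
      ← mul_kronecker_mul, ← mul_kronecker_mul, ← mul_kronecker_mul, hL.eq, hD'.eq]
    simp only [mul_one, one_mul]
  · change Commute _ ((crossingMatrix N ((1 : Fin 2), b)).submatrix _ _)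
    rw [crossingMatrix_one, loweringTriple, commute_iff_eq, add_mul, mul_add, ← mul_kronecker_mul,
      ← mul_kronecker_mul, ← mul_kronecker_mul, ← mul_kronecker_mul, hL.eq, hD.eq]
    simp only [mul_one, one_mul]

theorem braidMatrix_commute_loweringTriple (N : ℕ) (w : BraidWord 2) :
    Commute (loweringTriple N)
      ((braidMatrix N w).submatrix (tripleEquiv N) (tripleEquiv N)) := by
  induction w with
  | nil => simp [braidMatrix]
  | cons c w ih =>
    have h : braidMatrix N (c :: w) = crossingMatrix N c * braidMatrix N w := by
      simp [braidMatrix]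
    rw [h, ← submatrix_mul_equiv _ _ _ (tripleEquiv N)]
    exact (crossingMatrix_commute_loweringTriple N c).mul_right ih

theorem tangleOperator_eq_sum (N : ℕ) (w : BraidWord 2) (i j : Fin N) :
    tangleOperator N w i j = ∑ c : Fin N × Fin N,
      T (2 * (((c.1 + c.2 : ℕ) : ℤ) - N + 1))
        * (braidMatrix N w).submatrix (tripleEquiv N) (tripleEquiv N) (i, c) (j, c) := by
  rw [tangleOperator, ← (finTwoArrowEquiv (Fin N)).symm.sum_comp]
  refine sum_congr rfl fun c _ => ?_
  simp only [Fin.prod_univ_two, ← T_add, submatrix_apply, tripleEquiv,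
    finTwoArrowEquiv_symm_apply, cons_val_zero, cons_val_one]
  congr 2
  push_cast
  ring

theorem loweringPair_eq_zero {N : ℕ} {x y : Fin N × Fin N}
    (h : (x.1 + x.2 : ℕ) ≠ y.1 + y.2 + 1) : loweringPair N x y = 0 := by
  obtain ⟨i, j⟩ := x
  obtain ⟨k, l⟩ := y
  simp only at h
  simp only [loweringPair, Matrix.add_apply, kroneckerMap_apply, loweringMatrix, weightMatrix,
    coweightMatrix, diagonal_apply]
  split_ifs with h1 h2 h3 h4 <;> first | (exfalso; subst_vars; omega) | simp

/-- Take the `(i, c), (j, c)` entries of the commutation relation, weight them by `T (c₁ + c₂)` and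
sum over `c`. Where the lowering operator acts on the open strand, the weight becomes `T (2 (c₁ +
c₂))`, which is that of the quantum trace up to a constant. Where it acts on the closed strands, the
two sides cancel by cyclicity of the trace. -/
theorem quantumTrace_succ {N : ℕ} {B : Matrix (Fin N × Fin N × Fin N) (Fin N × Fin N × Fin N) ℤ[T;T⁻¹]}
    (hc : loweringTriple N * B = B * loweringTriple N) (i j : Fin N) (hij : (i : ℕ) = j + 1) :
    ∑ c : Fin N × Fin N, T (2 * (((c.1 + c.2 : ℕ) : ℤ) - N + 1)) * B (i, c) (i, c)
      = ∑ c : Fin N × Fin N, T (2 * (((c.1 + c.2 : ℕ) : ℤ) - N + 1)) * B (j, c) (j, c) := by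
  have hl (c : Fin N × Fin N) : (loweringTriple N * B) (i, c) (j, c)
      = qNum (N - i) * T ((c.1 + c.2 : ℕ) : ℤ) * B (j, c) (j, c)
        + T ((N : ℤ) - 1 - (i : ℕ)) * ∑ c', loweringPair N c c' * B (i, c') (j, c) := by
    rw [loweringTriple, add_mul, Matrix.add_apply, mul_apply, mul_apply, weightMatrix_kronecker,
      Fintype.sum_prod_type, Fintype.sum_prod_type]
    congr 1
    · rw [sum_eq_single j]
      · simp [kroneckerMap_apply, diagonal_apply, loweringMatrix, hij]
      · intro b _ hb
        have : (i : ℕ) ≠ b + 1 := fun h => hb (Fin.ext (by omega))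
        simp [kroneckerMap_apply, loweringMatrix, this]
      · simp
    · rw [sum_eq_single i]
      · simp [kroneckerMap_apply, coweightMatrix, mul_sum, mul_assoc]
      · intro b _ hb
        simp [kroneckerMap_apply, coweightMatrix, hb.symm]
      · simp
  have hr (c : Fin N × Fin N) : (B * loweringTriple N) (i, c) (j, c)
      = qNum (N - i) * T ((c.1 + c.2 : ℕ) : ℤ) * B (i, c) (i, c)
        + T ((N : ℤ) - 1 - (j : ℕ)) * ∑ c', loweringPair N c' c * B (i, c) (j, c') := by
    rw [loweringTriple, mul_add, Matrix.add_apply, mul_apply, mul_apply, weightMatrix_kronecker,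
      Fintype.sum_prod_type, Fintype.sum_prod_type]
    congr 1
    · rw [sum_eq_single i]
      · simp only [kroneckerMap_apply, diagonal_apply, loweringMatrix, hij, mul_ite, mul_zero,
          sum_ite_eq', mem_univ, if_true]
        ring
      · intro b _ hb
        have : (b : ℕ) ≠ j + 1 := fun h => hb (Fin.ext (by omega))
        simp [kroneckerMap_apply, loweringMatrix, this]
      · simp
    · rw [sum_eq_single j]
      · rw [mul_sum]
        refine sum_congr rfl fun c' _ => ?_
        simp only [kroneckerMap_apply, coweightMatrix, diagonal_apply_eq]
        ring
      · intro b _ hb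
        simp [kroneckerMap_apply, coweightMatrix, hb]
      · simp
  -- A nonzero `loweringPair N c c'` forces the label sum of `c` to exceed that of `c'` by one. This
  -- shift compensates the difference of the coweights at `i = j + 1`.
  have hswap : ∑ c : Fin N × Fin N, T ((c.1 + c.2 : ℕ) : ℤ)
        * (T ((N : ℤ) - 1 - (i : ℕ)) * ∑ c', loweringPair N c c' * B (i, c') (j, c))
      = ∑ c : Fin N × Fin N, T ((c.1 + c.2 : ℕ) : ℤ)
        * (T ((N : ℤ) - 1 - (j : ℕ)) * ∑ c', loweringPair N c' c * B (i, c) (j, c')) := by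
    simp only [mul_sum]
    rw [sum_comm]
    refine sum_congr rfl fun c' _ => sum_congr rfl fun c _ => ?_
    by_cases h : (c.1 + c.2 : ℕ) = c'.1 + c'.2 + 1
    · rw [← mul_assoc, ← mul_assoc (T _), ← T_add, ← T_add, h, hij]
      congr 2
      push_cast
      ring
    · rw [loweringPair_eq_zero h]
      simp
  have hsum : ∑ c : Fin N × Fin N, T ((c.1 + c.2 : ℕ) : ℤ) * (loweringTriple N * B) (i, c) (j, c)
      = ∑ c : Fin N × Fin N, T ((c.1 + c.2 : ℕ) : ℤ) * (B * loweringTriple N) (i, c) (j, c) := by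
    rw [hc]
  simp only [hl, hr, mul_add, sum_add_distrib, hswap] at hsum
  have hsum := add_right_cancel hsum
  have hT (k : Fin N) : qNum (N - i) * T (2 * ((N : ℤ) - 1)) * ∑ c : Fin N × Fin N,
      T (2 * (((c.1 + c.2 : ℕ) : ℤ) - N + 1)) * B (k, c) (k, c)
      = ∑ c : Fin N × Fin N, T ((c.1 + c.2 : ℕ) : ℤ)
        * (qNum (N - i) * T ((c.1 + c.2 : ℕ) : ℤ) * B (k, c) (k, c)) := by
    rw [mul_sum]
    refine sum_congr rfl fun c _ => ?_
    have : (T (2 * ((N : ℤ) - 1)) * T (2 * (((c.1 + c.2 : ℕ) : ℤ) - N + 1)) : ℤ[T;T⁻¹])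
        = T ((c.1 + c.2 : ℕ) : ℤ) * T ((c.1 + c.2 : ℕ) : ℤ) := by
      rw [← T_add, ← T_add]; congr 1; ring
    linear_combination qNum (N - i) * B (k, c) (k, c) * this
  refine mul_left_cancel₀ (mul_ne_zero (qNum_ne_zero (Nat.sub_pos_of_lt i.2))
    (isUnit_T (R := ℤ) (2 * ((N : ℤ) - 1))).ne_zero) ?_
  rw [hT, hT, hsum]

/-- Consecutive diagonal entries of the operator of a `(1, 1)`-tangle agree. -/
theorem tangleOperator_succ {N : ℕ} (w : BraidWord 2) (i j : Fin N) (hij : (i : ℕ) = j + 1) :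
    tangleOperator N w i i = tangleOperator N w j j := by
  rw [tangleOperator_eq_sum, tangleOperator_eq_sum]
  exact quantumTrace_succ (braidMatrix_commute_loweringTriple N w) i j hij

theorem tangleOperator_apply_self {N : ℕ} (w : BraidWord 2) (hN : 0 < N) (i : Fin N) :
    tangleOperator N w i i = tangleOperator N w ⟨0, hN⟩ ⟨0, hN⟩ := by
  obtain ⟨i, hi⟩ := i
  induction i with
  | zero => rfl
  | succ i ih => rw [← ih (by omega), tangleOperator_succ w ⟨i + 1, hi⟩ ⟨i, by omega⟩ rfl]

end LoweringOperator

/-! ### From the double sum to the cyclotomic expansion -/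

section QBinomialSums

open LaurentPolynomial Finset

/-- The `q`-binomial theorem. -/
theorem prod_one_sub_T (n : ℕ) (e : ℤ) :
    ∏ i ∈ range n, (1 - T (e + 2 * i) : ℤ[T;T⁻¹])
      = ∑ w ∈ range (n + 1), (-1) ^ w * qBinom n w * T (w * ((n : ℤ) - 1) + w * e) := by
  induction n with
  | zero => simp [qBinom_zero_right]
  | succ n ih =>
    rw [prod_range_succ, ih, sum_range_succ' _ (n + 1)]
    have h (w : ℕ) : (-1) ^ (w + 1) * qBinom (n + 1) (w + 1)
          * T ((w + 1 : ℕ) * (((n + 1 : ℕ) : ℤ) - 1) + (w + 1 : ℕ) * e)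
        = (-1) ^ (w + 1) * qBinom n (w + 1) * T ((w + 1 : ℕ) * ((n : ℤ) - 1) + (w + 1 : ℕ) * e)
          - (-1) ^ w * qBinom n w * T (w * ((n : ℤ) - 1) + w * e) * T (e + 2 * n) := by
      have e1 : (T (-((w : ℤ) + 1)) * T ((w + 1 : ℕ) * (((n + 1 : ℕ) : ℤ) - 1) + (w + 1 : ℕ) * e)
          : ℤ[T;T⁻¹]) = T ((w + 1 : ℕ) * ((n : ℤ) - 1) + (w + 1 : ℕ) * e) := by
        rw [← T_add]; congr 1; push_cast; ring
      have e2 : (T ((n : ℤ) - w) * T ((w + 1 : ℕ) * (((n + 1 : ℕ) : ℤ) - 1) + (w + 1 : ℕ) * e)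
          : ℤ[T;T⁻¹]) = T (w * ((n : ℤ) - 1) + w * e) * T (e + 2 * n) := by
        rw [← T_add, ← T_add]; congr 1; push_cast; ring
      rw [qBinom]
      linear_combination (-1) ^ (w + 1) * qBinom n (w + 1) * e1 + (-1) ^ (w + 1) * qBinom n w * e2
    set F : ℕ → ℤ[T;T⁻¹] := fun w => (-1) ^ w * qBinom n w * T (w * ((n : ℤ) - 1) + w * e) with hF
    have hz : ∑ w ∈ range (n + 1), F (w + 1) = ∑ w ∈ range (n + 1), F w - F 0 := by
      have h1 := sum_range_succ' F (n + 1)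
      have h2 : F (n + 1) = 0 := by rw [hF]; simp [qBinom_eq_zero_of_lt]
      rw [sum_range_succ, h2, add_zero] at h1
      rw [h1, add_sub_cancel_right]
    have h0 : F 0 = 1 := by simp [hF, qBinom_zero_right]
    rw [sum_congr rfl fun w _ => h w, sum_sub_distrib, ← sum_mul, hz, h0]
    simp only [qBinom_zero_right, Nat.cast_zero, zero_mul, add_zero, T_zero, pow_zero]
    ring

theorem qNum_eq_T_mul {Z x : ℕ} (h : x ≤ Z) :
    qNum (Z - x) = T ((Z : ℤ) - x) * (1 - T (-2 * (Z : ℤ) + 2 * x)) := by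
  rw [qNum, mul_sub, mul_one, ← T_add, Nat.cast_sub h]
  congr 2
  ring

theorem prod_qNum_sub (n Z : ℕ) (h : n ≤ Z) :
    ∏ x ∈ range n, qNum (Z - x) = T (n * (Z : ℤ) - (n.choose 2 : ℕ))
      * ∏ x ∈ range n, (1 - T (-2 * (Z : ℤ) + 2 * x) : ℤ[T;T⁻¹]) := by
  induction n with
  | zero => simp
  | succ n ih =>
    rw [prod_range_succ, prod_range_succ, ih (by omega), qNum_eq_T_mul (by omega),
      Nat.choose_succ_succ' n 1, Nat.choose_one_right]
    have h1 : (T ((n + 1 : ℕ) * (Z : ℤ) - (n + n.choose 2 : ℕ)) : ℤ[T;T⁻¹])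
        = T (n * (Z : ℤ) - (n.choose 2 : ℕ)) * T ((Z : ℤ) - n) := by
      rw [← T_add]; congr 1; push_cast; ring
    rw [h1, mul_mul_mul_comm]

theorem qBinom_mul_qBinom_comm (v w k : ℕ) :
    qBinom (k + v + w) v * qBinom (k + w) w = qBinom (k + v + w) w * qBinom (k + v) v := by
  have h1 := qBinom_mul_qFactorial (k + w) v
  have h2 := qBinom_mul_qFactorial k w
  have h3 := qBinom_mul_qFactorial (k + v) w
  have h4 := qBinom_mul_qFactorial k v
  rw [show k + w + v = k + v + w by ring] at h1
  refine mul_right_cancel₀ (mul_ne_zero (qFactorial_ne_zero k)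
    (mul_ne_zero (qFactorial_ne_zero v) (qFactorial_ne_zero w))) ?_
  rw [← h2] at h1
  rw [← h4] at h3
  linear_combination h1 - h3

/-- The second Pascal rule is the image of the first under `t ↦ t⁻¹`. -/
theorem qBinom_succ_succ (a b : ℕ) :
    qBinom (a + 1) (b + 1) = T ((b : ℤ) + 1) * qBinom a (b + 1) + T ((b : ℤ) - a) * qBinom a b := by
  rw [← invert_qBinom, qBinom, map_add, map_mul, map_mul, invert_qBinom, invert_qBinom, invert_T,
    invert_T, neg_neg, neg_sub]

/-- The `q`-Chu–Vandermonde sum, in the degenerate case `₂φ₁(q^{-L}, q^{k+1}; 0; q, q)`. -/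
theorem sum_qBinom_mul_prod_qNum (k L : ℕ) :
    ∑ w ∈ range (L + 1), (-1) ^ w * qBinom (k + w) w * (∏ x ∈ range w, qNum (L - x))
        * T (w * ((L : ℤ) - k) - (w.choose 2 : ℕ) - 2 * w)
      = T (-2 * L * ((k : ℤ) + 1)) := by
  induction L generalizing k with
  | zero => simp [qBinom_zero_right]
  | succ L ihL =>
    have hprod (w : ℕ) : ∏ x ∈ range (w + 1), qNum (L + 1 - x)
        = (∏ x ∈ range w, qNum (L - x)) * qNum (L + 1) := by
      rw [prod_range_succ']
      simp only [Nat.add_sub_add_right, Nat.sub_zero]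
    have hT (w : ℕ) (k : ℕ) : (T (-(k : ℤ)) * T ((w + 1 : ℕ) * (((L + 1 : ℕ) : ℤ) - k)
          - ((w + 1).choose 2 : ℕ) - 2 * (w + 1 : ℕ)) : ℤ[T;T⁻¹])
        = T (w * ((L : ℤ) - k) - (w.choose 2 : ℕ) - 2 * w) * T ((L : ℤ) - 1 - 2 * k) := by
      rw [← T_add, ← T_add, Nat.choose_succ_succ' w 1, Nat.choose_one_right]
      congr 1
      push_cast
      ring
    -- With `S(k, L)` the sum in question, Pascal's rule gives `S(k + 1, L + 1) = S(k, L + 1) - {L +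
    -- 1} T (L - 3 - 2 k) S(k + 1, L)`. The closed form satisfies the same recursion. For `k = 0` on
    -- the left of the identity, `1` takes the place of `S(k, L + 1)`.
    have hfin (k : ℤ) : T (-2 * (L + 1 : ℕ) * k)
          - qNum (L + 1) * T ((L : ℤ) - 1 - 2 * k) * T (-2 * L * (k + 1))
        = (T (-2 * (L + 1 : ℕ) * (k + 1)) : ℤ[T;T⁻¹]) := by
      rw [qNum, sub_mul, sub_mul, ← T_add, ← T_add, ← T_add, ← T_add]
      push_cast
      ring_nf
    induction k with
    | zero =>
      rw [← hfin, ← ihL, sum_range_succ', mul_sum]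
      refine (add_comm _ _).trans (Eq.trans ?_ (sub_eq_add_neg _ _).symm)
      rw [← sum_neg_distrib]
      congr 1
      · simp [qBinom_self]
      · refine sum_congr rfl fun w _ => ?_
        have := hT w 0
        simp only [Nat.cast_zero, neg_zero, T_zero, one_mul] at this
        rw [Nat.cast_zero, this, hprod, zero_add, zero_add, qBinom_self, qBinom_self]
        ring
    | succ k ihk =>
      rw [← hfin]
      push_cast at ihk ⊢
      rw [← ihk]
      have ih := ihL (k + 1)
      push_cast at ih
      rw [← ih, sum_range_succ', sum_range_succ' _ (L + 1), mul_sum]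
      refine Eq.trans ?_ (add_sub_right_comm _ _ _).symm
      rw [← sum_sub_distrib]
      congr 1
      · refine sum_congr rfl fun w _ => ?_
        have h1 := hT w (k + 1)
        have h2 := qBinom_succ_succ (k + 1 + w) w
        have h3 : (T ((w : ℤ) + 1) * T (((w : ℤ) + 1) * ((L : ℤ) + 1 - (k + 1))
            - ((w + 1).choose 2 : ℕ) - 2 * ((w : ℤ) + 1)) : ℤ[T;T⁻¹])
            = T (((w : ℤ) + 1) * ((L : ℤ) + 1 - k) - ((w + 1).choose 2 : ℕ)
              - 2 * ((w : ℤ) + 1)) := by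
          rw [← T_add]; congr 1; ring
        rw [show (w : ℤ) - ((k + 1 + w : ℕ) : ℤ) = -((k + 1 : ℕ) : ℤ) by push_cast; ring] at h2
        push_cast at h1 h2 ⊢
        rw [hprod, show k + 1 + (w + 1) = k + 1 + w + 1 by ring, h2,
          show k + (w + 1) = k + 1 + w by ring]
        linear_combination (-1) ^ (w + 1) * qBinom (k + 1 + w) (w + 1)
            * (∏ x ∈ range w, qNum (L - x)) * qNum (L + 1) * h3
          + (-1) ^ (w + 1) * qBinom (k + 1 + w) w
            * (∏ x ∈ range w, qNum (L - x)) * qNum (L + 1) * h1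
      · simp [qBinom_zero_right]

theorem sum_range_sum_range_comm {A : Type*} [AddCommMonoid A] (u : ℕ) (f : ℕ → ℕ → A) :
    ∑ v ∈ range (u + 1), ∑ w ∈ range (u - v + 1), f v w
      = ∑ w ∈ range (u + 1), ∑ v ∈ range (u - w + 1), f v w :=
  sum_comm' fun v w => by simp only [mem_range]; omega

theorem sum_range_sum_range_succ {A : Type*} [AddCommMonoid A] (M : ℕ) (f : ℕ → ℕ → A) :
    ∑ u ∈ range (M + 1), ∑ w ∈ range (u + 1), f u w
      = ∑ k ∈ range (M + 1), ∑ w ∈ range (M - k + 1), f (k + w) w := by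
  have h (u : ℕ) : ∑ w ∈ range (u + 1), f u w = ∑ k ∈ range (u + 1), f u (u - k) := by
    rw [← sum_range_reflect]
    simp only [Nat.add_sub_cancel]
  simp only [h]
  rw [sum_comm' (t' := range (M + 1)) (s' := fun k => Ico k (M + 1))
    fun u k => by simp only [mem_range, mem_Ico]; omega]
  refine sum_congr rfl fun k hk => ?_
  have := mem_range.1 hk
  rw [sum_Ico_eq_sum_range, show M + 1 - k = M - k + 1 by omega]
  simp only [Nat.add_sub_cancel_left]

/-- Expand the product by the `q`-binomial theorem with summation index `w`, exchange the sums using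
the symmetry of the trinomial coefficient, and resum over `v` by the same theorem read backwards. -/
theorem sum_qBinom_mul_prod_qNum_sub {M u : ℕ} (hu : u ≤ M) :
    ∑ v ∈ range (u + 1), (-1) ^ v * qBinom u v * (∏ x ∈ range (u - v), qNum (M - v - x))
        * T ((M : ℤ) * (2 * u - v + 2) - 2 * (u.choose 2 : ℕ) - (v.choose 2 : ℕ) - u * v - 2 * u
          - 3 * v)
      = ∑ w ∈ range (u + 1), (-1) ^ w * qBinom u w
        * T (2 * ((M : ℤ) - (u - w)) * (u - w + 1) + w * ((M : ℤ) - (u - w) - (u - w))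
          - (w.choose 2 : ℕ) - 2 * w)
        * ∏ x ∈ range (u - w), qNum (M + 1 + (u - w) - x) := by
  have h1 : ∀ v ∈ range (u + 1), (-1) ^ v * qBinom u v
        * (∏ x ∈ range (u - v), qNum (M - v - x))
        * T ((M : ℤ) * (2 * u - v + 2) - 2 * (u.choose 2 : ℕ) - (v.choose 2 : ℕ) - u * v - 2 * u
          - 3 * v)
      = ∑ w ∈ range (u - v + 1), (-1) ^ w * qBinom u w
        * T (2 * ((M : ℤ) - (u - w)) * (u - w + 1) + w * ((M : ℤ) - (u - w) - (u - w))
          - (w.choose 2 : ℕ) - 2 * w)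
        * T ((u - w : ℕ) * ((M + 1 + (u - w) : ℕ) : ℤ) - ((u - w).choose 2 : ℕ))
        * ((-1) ^ v * qBinom (u - w) v * T (v * (((u - w : ℕ) : ℤ) - 1)
          + v * (-2 * ((M + 1 + (u - w) : ℕ) : ℤ)))) := by
    intro v hv
    have hv := mem_range_succ_iff.1 hv
    rw [prod_qNum_sub _ _ (by omega), prod_one_sub_T, mul_sum, mul_sum, sum_mul]
    refine sum_congr rfl fun w hw => ?_
    have hw := mem_range_succ_iff.1 hw
    obtain ⟨b, rfl⟩ := Nat.exists_eq_add_of_le' hv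
    rw [Nat.add_sub_cancel] at hw ⊢
    obtain ⟨k, rfl⟩ := Nat.exists_eq_add_of_le' hw
    have hb := qBinom_mul_qBinom_comm v w k
    have huw : k + w + v - w = k + v := by omega
    rw [show k + v + w = k + w + v by ring] at hb
    rw [huw]
    have he : (T (((k + w : ℕ) : ℤ) * ((M - v : ℕ) : ℤ) - ((k + w).choose 2 : ℕ))
        * T (w * (((k + w : ℕ) : ℤ) - 1) + w * (-2 * ((M - v : ℕ) : ℤ)))
        * T ((M : ℤ) * (2 * (k + w + v : ℕ) - v + 2) - 2 * ((k + w + v).choose 2 : ℕ)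
          - (v.choose 2 : ℕ) - (k + w + v : ℕ) * v - 2 * (k + w + v : ℕ) - 3 * v) : ℤ[T;T⁻¹])
        = T (2 * ((M : ℤ) - ((k + w + v : ℕ) - w)) * ((k + w + v : ℕ) - w + 1)
            + w * ((M : ℤ) - ((k + w + v : ℕ) - w) - ((k + w + v : ℕ) - w))
            - (w.choose 2 : ℕ) - 2 * w)
          * T (((k + v : ℕ) : ℤ) * ((M + 1 + (k + v) : ℕ) : ℤ) - ((k + v).choose 2 : ℕ))
          * T (v * (((k + v : ℕ) : ℤ) - 1) + v * (-2 * ((M + 1 + (k + v) : ℕ) : ℤ))) := by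
      simp only [← T_add]
      congr 1
      have c1 := two_mul_choose_two v
      have c2 := two_mul_choose_two w
      have c3 := two_mul_choose_two (k + w)
      have c4 := two_mul_choose_two (k + v)
      have c5 := two_mul_choose_two (k + w + v)
      -- Doubling makes the binomials `choose 2` polynomial, via `two_mul_choose_two`.
      refine mul_left_cancel₀ (two_ne_zero (α := ℤ)) ?_
      push_cast [Nat.cast_sub (show v ≤ M by omega)] at c3 c4 c5 ⊢
      linear_combination -c3 - 2 * c5 - c1 + c2 + c4
    linear_combination (-1) ^ v * (-1) ^ w * qBinom (k + w + v) v * qBinom (k + w) w * he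
      + (-1) ^ v * (-1) ^ w * T (2 * ((M : ℤ) - ((k + w + v : ℕ) - w)) * ((k + w + v : ℕ) - w + 1)
            + w * ((M : ℤ) - ((k + w + v : ℕ) - w) - ((k + w + v : ℕ) - w))
            - (w.choose 2 : ℕ) - 2 * w)
          * T (((k + v : ℕ) : ℤ) * ((M + 1 + (k + v) : ℕ) : ℤ) - ((k + v).choose 2 : ℕ))
          * T (v * (((k + v : ℕ) : ℤ) - 1) + v * (-2 * ((M + 1 + (k + v) : ℕ) : ℤ))) * hb
  rw [sum_congr rfl h1, sum_range_sum_range_comm]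
  refine sum_congr rfl fun w hw => ?_
  rw [← mul_sum, ← prod_one_sub_T, prod_qNum_sub _ _ (by omega)]
  ring

theorem prod_range_qNum_add (k n : ℕ) :
    ∏ x ∈ range k, qNum (n + k - x) = ∏ j ∈ range k, qNum (n + (j + 1)) := by
  rw [← prod_range_reflect]
  refine prod_congr rfl fun x hx => ?_
  have := mem_range.1 hx
  congr 1
  omega

/-- The double sum given by the R-matrix equals the cyclotomic expansion. -/
theorem sum_eq_cyclotomic_expansion (M : ℕ) :
    ∑ u ∈ range (M + 1), ∑ v ∈ range (u + 1), (∏ x ∈ range u, qNum (M - x)) *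
      ((-1) ^ v * qBinom u v * (∏ x ∈ range (u - v), qNum (M - v - x))
        * T ((M : ℤ) * (2 * u - v + 2) - 2 * (u.choose 2 : ℕ) - (v.choose 2 : ℕ) - u * v - 2 * u
          - 3 * v))
      = ∑ k ∈ range (M + 1),
        ∏ j ∈ range k, (qNum (M + 1 + (j + 1)) * qNum (M + 1 - (j + 1))) := by
  have h : ∀ u ∈ range (M + 1), ∑ v ∈ range (u + 1), (∏ x ∈ range u, qNum (M - x)) *
      ((-1) ^ v * qBinom u v * (∏ x ∈ range (u - v), qNum (M - v - x))
        * T ((M : ℤ) * (2 * u - v + 2) - 2 * (u.choose 2 : ℕ) - (v.choose 2 : ℕ) - u * v - 2 * u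
          - 3 * v)) = ∑ w ∈ range (u + 1), (∏ x ∈ range u, qNum (M - x)) * ((-1) ^ w * qBinom u w
        * T (2 * ((M : ℤ) - (u - w)) * (u - w + 1) + w * ((M : ℤ) - (u - w) - (u - w))
          - (w.choose 2 : ℕ) - 2 * w)
        * ∏ x ∈ range (u - w), qNum (M + 1 + (u - w) - x)) := by
    intro u hu
    rw [← mul_sum, sum_qBinom_mul_prod_qNum_sub (mem_range_succ_iff.1 hu), mul_sum]
  -- Set `u = k + w`. With `L = M - k`, the sum over `w` is the Chu–Vandermonde sum, whose value
  -- cancels the remaining power `T (2 L (k + 1))`.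
  rw [sum_congr rfl h, sum_range_sum_range_succ]
  refine sum_congr rfl fun k hk => ?_
  have hk := mem_range_succ_iff.1 hk
  obtain ⟨L, rfl⟩ := Nat.exists_eq_add_of_le hk
  have hS := sum_qBinom_mul_prod_qNum k L
  rw [prod_mul_distrib, ← prod_range_qNum_add, Nat.add_sub_cancel_left]
  have hw (w : ℕ) : (∏ x ∈ range (k + w), qNum (k + L - x)) * ((-1) ^ w * qBinom (k + w) w
        * T (2 * (((k + L : ℕ) : ℤ) - ((k + w : ℕ) - w)) * ((k + w : ℕ) - w + 1)
          + w * (((k + L : ℕ) : ℤ) - ((k + w : ℕ) - w) - ((k + w : ℕ) - w))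
          - (w.choose 2 : ℕ) - 2 * w)
        * ∏ x ∈ range (k + w - w), qNum (k + L + 1 + (k + w - w) - x))
      = (∏ x ∈ range k, qNum (k + L + 1 + k - x)) * (∏ x ∈ range k, qNum (k + L - x))
        * T (2 * (L : ℤ) * (k + 1))
        * ((-1) ^ w * qBinom (k + w) w * (∏ x ∈ range w, qNum (L - x))
        * T (w * ((L : ℤ) - k) - (w.choose 2 : ℕ) - 2 * w)) := by
    rw [prod_range_add, Nat.add_sub_cancel]
    have h1 : ∏ x ∈ range w, qNum (k + L - (k + x)) = ∏ x ∈ range w, qNum (L - x) :=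
      prod_congr rfl fun x _ => by rw [Nat.add_sub_add_left]
    have h2 : (T (2 * (((k + L : ℕ) : ℤ) - ((k + w : ℕ) - w)) * ((k + w : ℕ) - w + 1)
          + w * (((k + L : ℕ) : ℤ) - ((k + w : ℕ) - w) - ((k + w : ℕ) - w))
          - (w.choose 2 : ℕ) - 2 * w) : ℤ[T;T⁻¹])
        = T (2 * (L : ℤ) * (k + 1)) * T (w * ((L : ℤ) - k) - (w.choose 2 : ℕ) - 2 * w) := by
      rw [← T_add]; congr 1; push_cast; ring
    rw [h1, h2]
    ring
  rw [sum_congr rfl fun w _ => hw w, ← mul_sum, hS, mul_assoc, ← T_add,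
    show 2 * (L : ℤ) * (k + 1) + -2 * L * (k + 1) = 0 by ring, T_zero, mul_one]
  congr 1
  refine prod_congr rfl fun x _ => ?_
  congr 1
  omega

end QBinomialSums

/-! ### State sum of the figure-eight knot -/

section FigureEight

open LaurentPolynomial Finset Matrix
open scoped Kronecker

/-- An entry of the operator of `σ₁ σ₂⁻¹`. -/
theorem crossingMatrix_mul_apply {N : ℕ} (b b' : Bool) (x y : Fin N × Fin N × Fin N) :
    ((crossingMatrix N ((0 : Fin 2), b)).submatrix (tripleEquiv N) (tripleEquiv N)
        * (crossingMatrix N ((1 : Fin 2), b')).submatrix (tripleEquiv N) (tripleEquiv N)) x y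
      = ∑ z, crossingPair N b (x.1, x.2.1) (y.1, z) * crossingPair N b' (z, x.2.2) y.2 := by
  obtain ⟨i, j, k⟩ := x
  obtain ⟨i', y⟩ := y
  rw [crossingMatrix_zero, crossingMatrix_one, mul_apply, Fintype.sum_prod_type,
    sum_eq_single i', Fintype.sum_prod_type]
  · refine sum_congr rfl fun z _ => ?_
    rw [sum_eq_single k]
    · simp [kroneckerMap_apply]
    · intro c _ hc
      simp [kroneckerMap_apply, one_apply, hc.symm]
    · simp
  · intro c _ hc
    simp [kroneckerMap_apply, one_apply, hc]
  · simp

/-- A positive crossing cannot raise the top label `M`, so only the term `m = 0` survives. The next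
lemma is the mirror case, with `M` outgoing. -/
theorem posR_last_left {M i k l : ℕ} (hl : l ≤ M) :
    posR (M + 1) M i k l = if k = i ∧ l = M then T ((M : ℤ) * (i - M - 1)) else 0 := by
  split_ifs with h
  · obtain ⟨rfl, rfl⟩ := h
    have h0 := posR_add (l + 1) l k 0
    simp only [add_zero, qBinom_zero_right, prod_range_zero, mul_one, one_mul] at h0
    rw [h0]
    congr 1
    rw [show ((0 : ℕ) + 1).choose 2 = 0 from rfl]
    push_cast
    ring
  · exact posR_eq_zero (by omega)

theorem posR_last_right {M i j l : ℕ} (hj : j ≤ M) :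
    posR (M + 1) i j M l = if j = M ∧ l = i then T ((M : ℤ) * (i - M - 1)) else 0 := by
  split_ifs with h
  · obtain ⟨rfl, rfl⟩ := h
    have h0 := posR_add (j + 1) l j 0
    simp only [add_zero, qBinom_zero_right, prod_range_zero, mul_one, one_mul] at h0
    rw [h0]
    congr 1
    rw [show ((0 : ℕ) + 1).choose 2 = 0 from rfl]
    push_cast
    ring
  · exact posR_eq_zero (by omega)

/-- With `M` entering and leaving on the open strand, both positive crossings are rigid.
Conservation of label sums then leaves `(i, M, j)` as the only intermediate state, so just the two
negative crossings contribute more than a monomial. -/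
theorem figureEight_last_apply (M : ℕ) (i j : Fin (M + 1)) :
    (braidMatrix (M + 1) figureEight).submatrix (tripleEquiv (M + 1)) (tripleEquiv (M + 1))
        (Fin.last M, i, j) (Fin.last M, i, j)
      = T (2 * (M : ℤ) * ((i : ℕ) - M - 1)) * negR (M + 1) M j M j * negR (M + 1) i j i j := by
  have hB : (braidMatrix (M + 1) figureEight).submatrix (tripleEquiv (M + 1)) (tripleEquiv (M + 1))
      = ((crossingMatrix (M + 1) ((0 : Fin 2), true)).submatrix (tripleEquiv _) (tripleEquiv _)
          * (crossingMatrix (M + 1) ((1 : Fin 2), false)).submatrix (tripleEquiv _) (tripleEquiv _))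
        * ((crossingMatrix (M + 1) ((0 : Fin 2), true)).submatrix (tripleEquiv _) (tripleEquiv _)
          * (crossingMatrix (M + 1) ((1 : Fin 2), false)).submatrix (tripleEquiv _)
            (tripleEquiv _)) := by
    simp only [submatrix_mul_equiv]
    simp [braidMatrix, figureEight, mul_assoc]
  have hM {x : Fin (M + 1)} (h : (x : ℕ) = M) : x = Fin.last M := Fin.ext h
  rw [hB, mul_apply, sum_eq_single (i, Fin.last M, j)]
  · rw [crossingMatrix_mul_apply, crossingMatrix_mul_apply, sum_eq_single (Fin.last M),
      sum_eq_single i]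
    · simp only [crossingPair, if_true, Fin.val_last, Bool.false_eq_true, if_false]
      rw [posR_last_left le_rfl, posR_last_right le_rfl, if_pos ⟨rfl, rfl⟩, if_pos ⟨rfl, rfl⟩,
        mul_mul_mul_comm, ← T_add, mul_assoc]
      congr 2
      ring
    · intro z _ hz
      have : (z : ℕ) ≠ i := fun h => hz (Fin.ext h)
      simp only [crossingPair, if_true, Fin.val_last]
      rw [posR_last_right le_rfl, if_neg (by tauto), zero_mul]
    · simp
    · intro z _ hz
      have : (z : ℕ) ≠ M := fun h => hz (hM h)
      simp only [crossingPair, if_true, Fin.val_last]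
      rw [posR_last_left (by omega), if_neg (by tauto), zero_mul]
    · simp
  · rintro ⟨a, b, c⟩ _ hne
    rw [crossingMatrix_mul_apply, crossingMatrix_mul_apply]
    simp only [crossingPair, if_true, Fin.val_last]
    by_cases ha : (a : ℕ) = i
    · by_cases hb : (b : ℕ) = M
      · have hc : (c : ℕ) ≠ j := fun h => hne (by rw [Fin.ext ha, hM hb, Fin.ext h])
        rw [sum_eq_zero, zero_mul]
        intro z _
        rw [posR_last_left (by omega)]
        by_cases h : (a : ℕ) = i ∧ (z : ℕ) = M
        · have := crossing_eq_zero (N := M + 1) (i := z) (j := j) (k := b) (l := c) false (by omega)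
          rw [this, mul_zero]
        · rw [if_neg h, zero_mul]
      · rw [mul_comm, sum_eq_zero, zero_mul]
        intro z _
        rw [posR_last_right (by omega), if_neg (by tauto), zero_mul]
    · rw [sum_eq_zero, zero_mul]
      intro z _
      rw [posR_last_left (by omega), if_neg (by tauto), zero_mul]
  · simp

theorem negR_eq_zero {N i j : ℕ} (h : i < j) : negR N i j i j = 0 := by
  rw [negR, posR_eq_zero (by omega), map_zero]

theorem negR_add (N j m : ℕ) :
    negR N (j + m) j (j + m) j
      = (-1) ^ m * (qBinom (j + m) m * ∏ x ∈ range m, qNum (N - (j + m) + x))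
        * T (-(2 * (j : ℤ) * (j + m) - (2 * (j : ℤ) + m + 1) * ((N : ℤ) - 1) + m * m
          - ((m + 1).choose 2 : ℕ))) := by
  rw [negR, posR_add, map_mul, map_mul, map_prod, invert_qBinom, invert_T]
  simp only [invert_qNum]
  rw [prod_neg, card_range]
  have h (a b : ℤ) (hab : a = b) (x y z : ℤ[T;T⁻¹]) : x * (y * z) * T a = y * (x * z) * T b := by
    rw [hab]; ring
  apply h
  ring

theorem qBinom_mul_prod_qNum (p u : ℕ) :
    qBinom (p + u) u * ∏ x ∈ range u, qNum (p + u + 1 - (p + u) + x)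
      = ∏ x ∈ range u, qNum (p + u - x) := by
  have h1 := prod_qNum_mul_qFactorial 0 u
  have h2 := prod_qNum_sub_mul_qFactorial p u
  rw [qFactorial_zero, mul_one, zero_add] at h1
  rw [Nat.add_sub_cancel_left]
  simp only [zero_add] at h1
  refine mul_right_cancel₀ (qFactorial_ne_zero p) ?_
  rw [h1, h2, ← qBinom_mul_qFactorial p u]
  ring

/-- Both sides are `{p + b}! {b + v}! / ({p}! {b}! {v}!)`. -/
theorem qBinom_mul_prod_qNum_comm (p b v : ℕ) :
    qBinom (p + b) b * ∏ x ∈ range b, qNum (p + b + v + 1 - (p + b) + x)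
      = qBinom (b + v) v * ∏ x ∈ range b, qNum (p + b - x) := by
  have h1 := prod_qNum_mul_qFactorial v b
  have h2 := prod_qNum_sub_mul_qFactorial p b
  have h3 := qBinom_mul_qFactorial p b
  have h4 := qBinom_mul_qFactorial b v
  rw [show p + b + v + 1 - (p + b) = v + 1 by omega]
  rw [show v + b = b + v by ring] at h1
  refine mul_right_cancel₀ (mul_ne_zero (qFactorial_ne_zero p)
    (mul_ne_zero (qFactorial_ne_zero b) (qFactorial_ne_zero v))) ?_
  linear_combination qFactorial v * (∏ x ∈ range b, qNum (v + 1 + x)) * h3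
    + qFactorial (p + b) * h1 - qFactorial b * qFactorial v * qBinom (b + v) v * h2
    - qFactorial (p + b) * h4

theorem figureEight_term {M u v : ℕ} (hu : u ≤ M) (hv : v ≤ u) :
    T (2 * (((M - v + (M - u) : ℕ) : ℤ) - (M + 1 : ℕ) + 1))
      * (T (2 * (M : ℤ) * ((M - v : ℕ) - M - 1)) * negR (M + 1) M (M - u) M (M - u)
        * negR (M + 1) (M - v) (M - u) (M - v) (M - u))
      = (∏ x ∈ range u, qNum (M - x)) *
      ((-1) ^ v * qBinom u v * (∏ x ∈ range (u - v), qNum (M - v - x))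
        * T ((M : ℤ) * (2 * u - v + 2) - 2 * (u.choose 2 : ℕ) - (v.choose 2 : ℕ) - u * v - 2 * u
          - 3 * v)) := by
  obtain ⟨p, rfl⟩ := Nat.exists_eq_add_of_le' hu
  obtain ⟨b, rfl⟩ := Nat.exists_eq_add_of_le' hv
  have h1 := negR_add (p + (b + v) + 1) p (b + v)
  have h2 := negR_add (p + (b + v) + 1) p b
  rw [qBinom_mul_prod_qNum] at h1
  rw [show p + (b + v) + 1 = p + b + v + 1 by ring, qBinom_mul_prod_qNum_comm] at h2
  rw [show p + (b + v) - (b + v) = p by omega, show p + (b + v) - v = p + b by omega,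
    show b + v - v = b by omega, h1, show p + (b + v) + 1 = p + b + v + 1 by ring, h2]
  have hT : (T (2 * (((p + b + p : ℕ) : ℤ) - (p + b + v + 1 : ℕ) + 1))
      * (T (2 * ((p + (b + v) : ℕ) : ℤ) * ((p + b : ℕ) - (p + (b + v) : ℕ) - 1))
      * T (-(2 * (p : ℤ) * (p + (b + v : ℕ))
        - (2 * (p : ℤ) + (b + v : ℕ) + 1) * (((p + b + v + 1 : ℕ) : ℤ) - 1)
        + (b + v : ℕ) * (b + v : ℕ) - ((b + v + 1).choose 2 : ℕ)))
      * T (-(2 * (p : ℤ) * (p + b) - (2 * (p : ℤ) + b + 1) * (((p + b + v + 1 : ℕ) : ℤ) - 1)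
        + b * b - ((b + 1).choose 2 : ℕ)))) : ℤ[T;T⁻¹])
      = T (((p + (b + v) : ℕ) : ℤ) * (2 * (b + v : ℕ) - v + 2) - 2 * ((b + v).choose 2 : ℕ)
        - (v.choose 2 : ℕ) - (b + v : ℕ) * v - 2 * (b + v : ℕ) - 3 * v) := by
    simp only [← T_add]
    congr 1
    have c1 := two_mul_choose_two v
    have c2 := two_mul_choose_two (b + 1)
    have c3 := two_mul_choose_two (b + v + 1)
    have c4 := two_mul_choose_two (b + v)
    refine mul_left_cancel₀ (two_ne_zero (α := ℤ)) ?_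
    push_cast at c1 c2 c3 c4 ⊢
    linear_combination c1 + c2 + c3 + 2 * c4
  have hs : ((-1) ^ (b + v) * (-1) ^ b : ℤ[T;T⁻¹]) = (-1) ^ v := by
    rw [← pow_add, show b + v + b = 2 * b + v by ring, pow_add, pow_mul]
    simp
  rw [← hT, ← hs]
  ring

/-- Habiro's and Lê's formula for the colored Jones polynomial of the figure-eight knot. -/
theorem coloredJones_figureEight (M : ℕ) :
    coloredJones (M + 1) figureEight = ∑ k ∈ range (M + 1),
      ∏ j ∈ range k, (qNum (M + 1 + (j + 1)) * qNum (M + 1 - (j + 1))) := by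
  rw [coloredJones, dif_pos M.succ_pos, ← tangleOperator_apply_self _ _ (Fin.last M),
    tangleOperator_eq_sum, ← sum_eq_cyclotomic_expansion, Fintype.sum_prod_type_right]
  simp only [figureEight_last_apply]
  let f : ℕ → ℕ → ℤ[T;T⁻¹] := fun j i => T (2 * (((i + j : ℕ) : ℤ) - (M + 1 : ℕ) + 1))
      * (T (2 * (M : ℤ) * (i - M - 1)) * negR (M + 1) M j M j * negR (M + 1) i j i j)
  change ∑ j : Fin (M + 1), ∑ i : Fin (M + 1), f j i = _
  -- Labels are counted down from the top: `u = M - j` and `v = M - i`. Terms with `v > u` vanish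
  -- because a negative crossing cannot raise its first label across.
  have h1 : ∑ j : Fin (M + 1), ∑ i : Fin (M + 1), f j i
      = ∑ u ∈ range (M + 1), ∑ v ∈ range (M + 1), f (M - u) (M - v) := by
    rw [Fin.sum_univ_eq_sum_range (fun j => ∑ i : Fin (M + 1), f j i), ← sum_range_reflect]
    refine sum_congr rfl fun u _ => ?_
    rw [Fin.sum_univ_eq_sum_range (f _), ← sum_range_reflect]
    rfl
  rw [h1]
  refine sum_congr rfl fun u hu => ?_
  have hu := mem_range_succ_iff.1 hu
  rw [← sum_subset (range_subset_range.2 (Nat.succ_le_succ hu))]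
  · refine sum_congr rfl fun v hv => ?_
    exact figureEight_term hu (mem_range_succ_iff.1 hv)
  · intro v hv hv'
    simp only [mem_range] at hv hv'
    simp only [f]
    rw [negR_eq_zero (show M - v < M - u by omega), mul_zero, mul_zero]

end FigureEight

/-! ### The Alexander polynomial and its uniqueness -/

section Alexander

open LaurentPolynomial Matrix

/-- The units of `ℤ[t, t⁻¹]` are the monomials with coefficient `±1`. -/
theorem eq_T_or_eq_neg_T_of_isUnit {u : ℤ[T;T⁻¹]} (hu : IsUnit u) :
    ∃ n : ℤ, u = T n ∨ u = -T n := by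
  obtain ⟨v, huv⟩ := hu.exists_right_inv
  obtain ⟨m, p, hp⟩ := exists_T_pow u
  obtain ⟨n, q, hq⟩ := exists_T_pow v
  -- Clearing denominators of a unit and its inverse gives polynomials whose product is a power of
  -- the prime `X`.
  have hpq : p * q = Polynomial.X ^ (m + n) := by
    apply Polynomial.toLaurent_injective
    rw [map_mul, hp, hq, Polynomial.toLaurent_X_pow, Nat.cast_add, T_add]
    linear_combination T (m : ℤ) * T (n : ℤ) * huv
  obtain ⟨i, _, hi⟩ := (dvd_prime_pow Polynomial.prime_X _).1 (Dvd.intro _ hpq)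
  obtain ⟨c, hc⟩ := hi.symm
  obtain ⟨r, hr, hrc⟩ := Polynomial.isUnit_iff.1 c.isUnit
  have hu' : u = Polynomial.toLaurent p * T (-(m : ℤ)) := by
    rw [hp, mul_T_assoc, add_neg_cancel, T_zero, mul_one]
  rw [← hc, ← hrc, map_mul, Polynomial.toLaurent_X_pow, Polynomial.toLaurent_C] at hu'
  refine ⟨i - m, ?_⟩
  rw [T_sub]
  rcases Int.isUnit_iff.1 hr with rfl | rfl
  · left; rw [hu', map_one]; ring
  · right; rw [hu', map_neg, map_one]; ring

theorem eval₂_one_T (n : ℤ) : eval₂ (RingHom.id ℤ) 1 (T n) = 1 := by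
  rw [eval₂_T]; simp

/-- Symmetry forces the exponent of the monomial to be `0`, and the value at `1` excludes the sign
`-1`. -/
theorem eq_one_of_isUnit {u : ℤ[T;T⁻¹]} (hu : IsUnit u) (hinv : invert u = u)
    (h1 : eval₂ (RingHom.id ℤ) 1 u = 1) : u = 1 := by
  obtain ⟨n, rfl | rfl⟩ := eq_T_or_eq_neg_T_of_isUnit hu
  · rw [invert_T] at hinv
    have h2 := congrArg (fun P : ℤ[T;T⁻¹] => P.coeff n) hinv
    simp only [T_apply] at h2
    have : n = 0 := by
      by_contra hn
      rw [if_neg (by omega)] at h2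
      simp at h2
    rw [this, T_zero]
  · rw [map_neg, eval₂_one_T] at h1
    norm_num at h1

theorem det_burauMatrix_figureEight :
    ((1 - burauMatrix figureEight).submatrix Fin.succ Fin.succ).det
      = T (-1) * (-T 1 + 3 - T (-1) : ℤ[T;T⁻¹]) := by
  have hT : (T 1 * T (-1) : ℤ[T;T⁻¹]) = 1 := by rw [← T_add]; simp
  have h0 : burauGenerator ((0 : Fin 2), true)
      = !![1 - T 1, T 1, 0; 1, 0, 0; 0, 0, (1 : ℤ[T;T⁻¹])] := by
    ext i j : 2
    fin_cases i <;> fin_cases j <;> simp [burauGenerator]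
  have h1 : burauGenerator ((1 : Fin 2), false)
      = !![1, 0, 0; 0, 0, 1; 0, T (-1), 1 - (T (-1) : ℤ[T;T⁻¹])] := by
    ext i j : 2
    fin_cases i <;> fin_cases j <;> simp [burauGenerator]
  have hw : burauMatrix figureEight = burauGenerator ((0 : Fin 2), true)
      * burauGenerator ((1 : Fin 2), false)
      * (burauGenerator ((0 : Fin 2), true) * burauGenerator ((1 : Fin 2), false)) := by
    simp [burauMatrix, figureEight, mul_assoc]
  rw [hw, h0, h1, det_fin_two, mul_fin_three, mul_fin_three, one_fin_three]
  generalize (T 1 : ℤ[T;T⁻¹]) = x at hT ⊢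
  generalize (T (-1) : ℤ[T;T⁻¹]) = y at hT ⊢
  simp
  linear_combination y * hT

theorem isAlexanderPolynomial_figureEight_iff (Δ : ℤ[T;T⁻¹]) :
    IsAlexanderPolynomial figureEight Δ ↔ Δ = -T 1 + 3 - T (-1) := by
  have hev : eval₂ (RingHom.id ℤ) 1 (-T 1 + 3 - T (-1) : ℤ[T;T⁻¹]) = 1 := by
    rw [map_sub, map_add, map_neg, eval₂_one_T, eval₂_one_T, map_ofNat]
    norm_num
  have hinv : invert (-T 1 + 3 - T (-1) : ℤ[T;T⁻¹]) = -T 1 + 3 - T (-1) := by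
    rw [map_sub, map_add, map_neg, invert_T, invert_T, neg_neg, map_ofNat]
    ring
  have hassoc : Associated ((1 - burauMatrix figureEight).submatrix Fin.succ Fin.succ).det
      (-T 1 + 3 - T (-1) : ℤ[T;T⁻¹]) := by
    rw [det_burauMatrix_figureEight]
    exact associated_unit_mul_left _ _ (isUnit_T _)
  constructor
  · rintro ⟨ha, hi, he⟩
    obtain ⟨u, hu⟩ := (ha.trans hassoc).symm
    have hne : (-T 1 + 3 - T (-1) : ℤ[T;T⁻¹]) ≠ 0 := by
      intro h
      rw [h, map_zero] at hev
      exact zero_ne_one hev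
    have hu1 : (u : ℤ[T;T⁻¹]) = 1 := by
      refine eq_one_of_isUnit u.isUnit ?_ ?_
      · rw [← hu, map_mul, hinv] at hi
        exact mul_left_cancel₀ hne hi
      · rw [← hu, map_mul, hev, one_mul] at he
        exact he
    rw [← hu, hu1, mul_one]
  · rintro rfl
    exact ⟨hassoc.symm, hinv, hev⟩

end Alexander

/-! ### Domination and passage to the limit -/

section Limit

open Filter Topology ComplexConjugate

/-- For `0 ≤ x ≤ 1` all values `sinh (a x)` lie in one closed quadrant, fixed by the signs of `a.re`
and `a.im`, because `cos (a.im x) ≥ 0`. Two vectors of one quadrant have nonnegative inner product.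
-/
theorem re_sinh_mul_conj_sinh_nonneg {a : ℂ} (ha : |a.im| < Real.pi / 3) {x y : ℝ} (hx : 0 ≤ x)
    (hx1 : x ≤ 1) (hy : 0 ≤ y) (hy1 : y ≤ 1) :
    0 ≤ (Complex.sinh (a * y) * conj (Complex.sinh (a * x))).re := by
  have hpi := Real.pi_pos
  have him (t : ℝ) (ht : 0 ≤ t) (ht1 : t ≤ 1) : |a.im * t| < Real.pi / 3 := by
    rw [abs_mul, abs_of_nonneg ht]
    exact (mul_le_of_le_one_right (abs_nonneg _) ht1).trans_lt ha
  have hcos (t : ℝ) (ht : 0 ≤ t) (ht1 : t ≤ 1) : 0 ≤ Real.cos (a.im * t) := by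
    have := abs_lt.1 (him t ht ht1)
    exact Real.cos_nonneg_of_mem_Icc ⟨by linarith, by linarith⟩
  have hsin : 0 ≤ Real.sin (a.im * y) * Real.sin (a.im * x) := by
    have h1 := abs_lt.1 (him x hx hx1)
    have h2 := abs_lt.1 (him y hy hy1)
    rcases le_total 0 a.im with h | h
    · exact mul_nonneg (Real.sin_nonneg_of_nonneg_of_le_pi (mul_nonneg h hy) (by linarith))
        (Real.sin_nonneg_of_nonneg_of_le_pi (mul_nonneg h hx) (by linarith))
    · exact mul_nonneg_of_nonpos_of_nonpos
        (Real.sin_nonpos_of_nonpos_of_neg_pi_le (mul_nonpos_of_nonpos_of_nonneg h hy) (by linarith))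
        (Real.sin_nonpos_of_nonpos_of_neg_pi_le (mul_nonpos_of_nonpos_of_nonneg h hx) (by linarith))
  have hsinh : 0 ≤ Real.sinh (a.re * y) * Real.sinh (a.re * x) := by
    rcases le_total 0 a.re with h | h
    · exact mul_nonneg (Real.sinh_nonneg_iff.2 (mul_nonneg h hy))
        (Real.sinh_nonneg_iff.2 (mul_nonneg h hx))
    · exact mul_nonneg_of_nonpos_of_nonpos
        (Real.sinh_nonpos_iff.2 (mul_nonpos_of_nonpos_of_nonneg h hy))
        (Real.sinh_nonpos_iff.2 (mul_nonpos_of_nonpos_of_nonneg h hx))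
  have hform (t : ℝ) : Complex.sinh (a * t)
      = ⟨Real.sinh (a.re * t) * Real.cos (a.im * t), Real.cosh (a.re * t) * Real.sin (a.im * t)⟩ := by
    have : a * t = ((a.re * t : ℝ) : ℂ) + ((a.im * t : ℝ) : ℂ) * Complex.I := by
      apply Complex.ext <;> simp
    rw [this, Complex.sinh_add, Complex.sinh_mul_I, Complex.cosh_mul_I]
    rw [← Complex.ofReal_sinh, ← Complex.ofReal_cosh, ← Complex.ofReal_cos, ← Complex.ofReal_sin]
    apply Complex.ext <;>
      simp [-Complex.ofReal_sinh, -Complex.ofReal_cosh, -Complex.ofReal_cos, -Complex.ofReal_sin]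
  rw [hform, hform]
  simp only [Complex.mul_re, Complex.conj_re, Complex.conj_im]
  have h1 := mul_nonneg hsinh (mul_nonneg (hcos y hy hy1) (hcos x hx hx1))
  have h2 := mul_nonneg hsin (mul_nonneg (Real.cosh_pos (a.re * y)).le (Real.cosh_pos (a.re * x)).le)
  linarith

theorem hasDerivAt_cosh_mul (a : ℂ) (x : ℝ) :
    HasDerivAt (fun y : ℝ => Complex.cosh (a * y)) (a * Complex.sinh (a * x)) x := by
  have h1 : HasDerivAt (fun z : ℂ => Complex.cosh (a * z)) (Complex.sinh (a * x) * (a * 1)) (x : ℂ) :=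
    ((hasDerivAt_id (x : ℂ)).const_mul a).ccosh
  have h2 := h1.comp_ofReal
  convert h2 using 1
  ring

/-- The difference is the integral of `a sinh (a y)` over `[x, 1]`, and each integrand has
nonnegative inner product with `a sinh (a x)`. Monotonicity in `y` replaces the integral. -/
theorem re_cosh_sub_mul_conj_nonneg {a : ℂ} (ha : |a.im| < Real.pi / 3) {x : ℝ} (hx : 0 ≤ x)
    (hx1 : x ≤ 1) :
    0 ≤ ((Complex.cosh a - Complex.cosh (a * x)) * conj (a * Complex.sinh (a * x))).re := by
  set w := conj (a * Complex.sinh (a * x)) with hw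
  have hd (y : ℝ) : HasDerivAt (fun y : ℝ => (Complex.cosh (a * y) * w).re)
      (a * Complex.sinh (a * y) * w).re y :=
    Complex.reCLM.hasFDerivAt.comp_hasDerivAt y ((hasDerivAt_cosh_mul a y).mul_const w)
  have hm : MonotoneOn (fun y : ℝ => (Complex.cosh (a * y) * w).re) (Set.Icc 0 1) := by
    refine monotoneOn_of_deriv_nonneg (convex_Icc 0 1)
      (fun y _ => (hd y).continuousAt.continuousWithinAt)
      (fun y _ => (hd y).differentiableAt.differentiableWithinAt) fun y hy => ?_
    rw [interior_Icc] at hy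
    rw [(hd y).deriv]
    have h := re_sinh_mul_conj_sinh_nonneg ha hx hx1 hy.1.le hy.2.le
    have e : a * Complex.sinh (a * y) * w
        = (Complex.normSq a : ℂ) * (Complex.sinh (a * y) * conj (Complex.sinh (a * x))) := by
      rw [hw, map_mul, ← Complex.mul_conj]; ring
    rw [e, Complex.re_ofReal_mul]
    exact mul_nonneg (Complex.normSq_nonneg a) h
  have := hm ⟨hx, hx1⟩ (Set.right_mem_Icc.2 zero_le_one) hx1
  simp only [Complex.ofReal_one, mul_one] at this
  rw [sub_mul, Complex.sub_re]
  linarith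

/-- The squared distance from `cosh (a x)` to `cosh a` decreases on `[0, 1]`: its derivative is `-2`
times the quantity of the preceding lemma. It is therefore largest at `x = 0`. -/
theorem norm_cosh_sub_cosh_le {a : ℂ} (ha : |a.im| < Real.pi / 3) {x : ℝ} (hx : 0 ≤ x)
    (hx1 : x ≤ 1) : ‖Complex.cosh a - Complex.cosh (a * x)‖ ≤ ‖Complex.cosh a - 1‖ := by
  have hd (y : ℝ) : HasDerivAt (fun y : ℝ => ‖Complex.cosh a - Complex.cosh (a * y)‖ ^ 2)
      (2 * inner ℝ (Complex.cosh a - Complex.cosh (a * y)) (-(a * Complex.sinh (a * y)))) y :=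
    ((hasDerivAt_cosh_mul a y).const_sub _).norm_sq
  have hm : AntitoneOn (fun y : ℝ => ‖Complex.cosh a - Complex.cosh (a * y)‖ ^ 2)
      (Set.Icc 0 1) := by
    refine antitoneOn_of_deriv_nonpos (convex_Icc 0 1)
      (fun y _ => (hd y).continuousAt.continuousWithinAt)
      (fun y _ => (hd y).differentiableAt.differentiableWithinAt) fun y hy => ?_
    rw [interior_Icc] at hy
    rw [(hd y).deriv, inner_neg_right, real_inner_comm, Complex.inner]
    have h := re_cosh_sub_mul_conj_nonneg ha hy.1.le hy.2.le
    linarith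
  have := hm (Set.left_mem_Icc.2 zero_le_one) ⟨hx, hx1⟩ hx
  simp only [Complex.ofReal_zero, mul_zero, Complex.cosh_zero] at this
  exact le_of_sq_le_sq this (norm_nonneg _)

theorem laurentEval_qNum (z : ℂˣ) (m : ℕ) :
    laurentEval z (qNum m) = (z : ℂ) ^ m - ((z : ℂ) ^ m)⁻¹ := by
  simp [laurentEval, qNum, LaurentPolynomial.eval₂_T]

theorem laurentEval_qNum_mul_qNum {N j : ℕ} (hN : 0 < N) (hj : j ≤ N) {a : ℂ} {z : ℂˣ}
    (hz : (z : ℂ) ^ 2 = Complex.exp (a / N)) :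
    laurentEval z (qNum (N + j) * qNum (N - j))
      = 2 * (Complex.cosh a - Complex.cosh (a * ((j / N : ℝ) : ℂ))) := by
  have hN' : (N : ℂ) ≠ 0 := Nat.cast_ne_zero.2 hN.ne'
  have hpow (m : ℕ) : (z : ℂ) ^ (2 * m) = Complex.exp (a * ((m / N : ℝ) : ℂ)) := by
    rw [pow_mul, hz, ← Complex.exp_nat_mul]
    congr 1
    push_cast
    ring
  have h1 := hpow N
  rw [div_self (Nat.cast_ne_zero.2 hN.ne'), Complex.ofReal_one, mul_one] at h1
  have hz0 : (z : ℂ) ≠ 0 := z.ne_zero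
  have hmul : laurentEval z (qNum (N + j) * qNum (N - j))
      = laurentEval z (qNum (N + j)) * laurentEval z (qNum (N - j)) := map_mul _ _ _
  rw [hmul, laurentEval_qNum, laurentEval_qNum, Complex.cosh, Complex.cosh, Complex.exp_neg,
    Complex.exp_neg, ← h1, ← hpow j]
  obtain ⟨i, rfl⟩ := Nat.exists_eq_add_of_le hj
  rw [Nat.add_sub_cancel_left]
  field_simp
  ring

theorem laurentEval_coloredJones_figureEight {N : ℕ} (hN : 0 < N) {a : ℂ} {z : ℂˣ}
    (hz : (z : ℂ) ^ 2 = Complex.exp (a / N)) :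
    laurentEval z (coloredJones N figureEight) = ∑' k : ℕ, if k < N then
      ∏ j ∈ Finset.range k, 2 * (Complex.cosh a - Complex.cosh (a * (((j + 1 : ℕ) / N : ℝ) : ℂ)))
      else 0 := by
  obtain ⟨M, rfl⟩ := Nat.exists_eq_add_of_le' hN
  rw [coloredJones_figureEight, laurentEval, map_sum,
    tsum_eq_sum (s := Finset.range (M + 1)) fun k hk => if_neg (by simpa using hk)]
  refine Finset.sum_congr rfl fun k hk => ?_
  have hk := Finset.mem_range.1 hk
  rw [if_pos hk, map_prod]
  refine Finset.prod_congr rfl fun j hj => ?_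
  have hj := Finset.mem_range.1 hj
  exact laurentEval_qNum_mul_qNum hN (by omega) hz

theorem tendsto_tsum_prod_cosh {a : ℂ} (ha : ‖2 * Complex.cosh a - 2‖ < 1)
    (him : |a.im| < Real.pi / 3) :
    Tendsto (fun N : ℕ => ∑' k : ℕ, if k < N then
      ∏ j ∈ Finset.range k, 2 * (Complex.cosh a - Complex.cosh (a * (((j + 1 : ℕ) / N : ℝ) : ℂ)))
      else 0) atTop (𝓝 (1 - (2 * Complex.cosh a - 2))⁻¹) := by
  rw [← tsum_geometric_of_norm_lt_one ha]
  refine tendsto_tsum_of_dominated_convergence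
    (summable_geometric_of_lt_one (norm_nonneg _) ha) (fun k => ?_) ?_
  · have h1 : Tendsto (fun N : ℕ => ∏ j ∈ Finset.range k,
        2 * (Complex.cosh a - Complex.cosh (a * (((j + 1 : ℕ) / N : ℝ) : ℂ)))) atTop
        (𝓝 (∏ _j ∈ Finset.range k, (2 * Complex.cosh a - 2))) := by
      refine tendsto_finsetProd _ fun j _ => ?_
      have hc : Continuous fun x : ℝ => 2 * (Complex.cosh a - Complex.cosh (a * (x : ℂ))) := by
        fun_prop
      have h2 := (hc.tendsto 0).comp (tendsto_const_div_atTop_nhds_zero_nat ((j + 1 : ℕ) : ℝ))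
      have h3 : 2 * (Complex.cosh a - Complex.cosh (a * ((0 : ℝ) : ℂ))) = 2 * Complex.cosh a - 2 := by
        rw [Complex.ofReal_zero, mul_zero, Complex.cosh_zero]; ring
      rw [h3] at h2
      exact h2
    rw [Finset.prod_const, Finset.card_range] at h1
    refine h1.congr' ?_
    filter_upwards [eventually_gt_atTop k] with N hN
    rw [if_pos hN]
  · refine Eventually.of_forall fun N k => ?_
    split_ifs with hk
    · rw [norm_prod]
      calc ∏ j ∈ Finset.range k,
            ‖2 * (Complex.cosh a - Complex.cosh (a * (((j + 1 : ℕ) / N : ℝ) : ℂ)))‖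
          ≤ ∏ _j ∈ Finset.range k, ‖2 * Complex.cosh a - 2‖ := by
            refine Finset.prod_le_prod (fun _ _ => norm_nonneg _) fun j hj => ?_
            have hj := Finset.mem_range.1 hj
            have hN : (0 : ℝ) < N := Nat.cast_pos.2 (by omega)
            have hx1 : ((j + 1 : ℕ) / N : ℝ) ≤ 1 :=
              (div_le_one hN).2 (Nat.cast_le.2 (by omega))
            have h := norm_cosh_sub_cosh_le him (x := ((j + 1 : ℕ) / N : ℝ)) (by positivity) hx1
            rw [show 2 * Complex.cosh a - 2 = 2 * (Complex.cosh a - 1) by ring, norm_mul, norm_mul]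
            exact mul_le_mul_of_nonneg_left h (norm_nonneg _)
        _ = ‖2 * Complex.cosh a - 2‖ ^ k := by rw [Finset.prod_const, Finset.card_range]
    · rw [norm_zero]
      positivity

theorem laurentEval_alexander_figureEight (a : ℂ) :
    laurentEval (Units.mk0 (Complex.exp a) (Complex.exp_ne_zero a))
      (-LaurentPolynomial.T 1 + 3 - LaurentPolynomial.T (-1)) = 1 - (2 * Complex.cosh a - 2) := by
  rw [laurentEval, map_sub, map_add, map_neg, map_ofNat, LaurentPolynomial.eval₂_T,
    LaurentPolynomial.eval₂_T, Complex.cosh, Complex.exp_neg]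
  simp
  ring

end Limit

theorem mainTheorem1 :
    ∃ Δ : ℤ[T;T⁻¹],
      (Δ = -LaurentPolynomial.T 1 + 3 - LaurentPolynomial.T (-1)) ∧
      (∀ Δ' : ℤ[T;T⁻¹], IsAlexanderPolynomial figureEight Δ' ↔ Δ' = Δ) ∧
      ∀ a : ℂ, ‖2 * Complex.cosh a - 2‖ < 1 → |a.im| < Real.pi / 3 →
        laurentEval (Units.mk0 (Complex.exp a) (Complex.exp_ne_zero a)) Δ ≠ 0 ∧
        -- `s N` is either one of the square roots of `t = exp (a / N)`
        ∀ s : ℕ → ℂˣ, (∀ N : ℕ, 2 ≤ N → (s N : ℂ) ^ 2 = Complex.exp (a / N)) →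
          Filter.Tendsto (fun N : ℕ => laurentEval (s N) (coloredJones N figureEight))
            Filter.atTop
            (nhds (1 / laurentEval (Units.mk0 (Complex.exp a) (Complex.exp_ne_zero a)) Δ)) := by
  refine ⟨_, rfl, isAlexanderPolynomial_figureEight_iff, fun a ha him => ?_⟩
  rw [laurentEval_alexander_figureEight]
  refine ⟨fun h => ?_, fun s hs => ?_⟩
  -- A zero of the Alexander polynomial would make the ratio of the geometric series equal to `1`.
  · rw [← sub_eq_zero.1 h, norm_one] at ha
    exact lt_irrefl _ ha
  · rw [one_div]
    refine (tendsto_tsum_prod_cosh ha him).congr' ?_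
    filter_upwards [Filter.eventually_ge_atTop 2] with N hN
    exact (laurentEval_coloredJones_figureEight (by omega) (hs N hN)).symm
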